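/- **Setting.** Let $N$ nodes estimate an unknown $x_0\in\mathbb R^n$ from the measurements $z_i(k)=H_i(k)x_0+v_i(k)$, $1\le i\le N$, $k\ge 0$, where $H_i(k)\in\mathbb R^{n_i\times n}$ is a random observation matrix and $v_i(k)\in\mathbb R^{n_i}$ is random noise. Let $\mathcal A(k)=[a_{ij}(k)]\in\mathbb R^{N\times N}$ be the random weighted adjacency matrix of the communication graph at time $k$ (real weights, $a_{ii}(k)=0$ a.s.), $\mathcal N_i(k)=\{j: a_{ij}(k)\ne0\}$, and let $\lambda_{ji}(k)\in\{0,\dots,d\}$ be the random delay on the link from $j$ to $i$. Starting from deterministic initial estimates $x_i(0)\in\mathbb R^n$, for $k\ge0$ put $$x_i(k+1)=x_i(k)+a(k)H_i^T(k)\big(z_i(k)-H_i(k)x_i(k)\big)+b(k)\sum_{j\in\mathcal N_i(k)}a_{ij}(k)\big(x_j(k-\lambda_{ji}(k))-x_i(k)\big),$$ and consider the delay-free case: $\lambda_{ji}(k)=0$ a.s. for all $i,j,k$ (values at negative times are then irrelevant). **Notation.** $H(k)=[H_1^T(k),\dots,H_N^T(k)]^T$, $v(k)=[v_1^T(k),\dots,v_N^T(k)]^T$,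 $\mathcal H(k)=\mathrm{diag}(H_1(k),\dots,H_N(k))$; $\mathcal L(k)=\mathrm{diag}\big(\sum_j a_{1j}(k),\dots,\sum_j a_{Nj}(k)\big)-\mathcal A(k)$ is the Laplacian and $\widehat{\mathcal L}(k)=\tfrac12(\mathcal L(k)+\mathcal L^T(k))$. $\mathcal F(k)$ is the $\sigma$-algebra generated by $\mathcal A(s),v(s),H_i(s),\lambda_{ji}(s)$, $1\le i,j\le N$, $0\le s\le k$, and $\mathcal F(-1)$ is trivial. $\|\cdot\|$ is the Euclidean norm of vectors and the 2-norm of matrices, $\otimes$ is the Kronecker product, and for integers $h\ge1$, $m\ge0$ $$\lambda_m^h=\lambda_{\min}\Big[\sum_{k=mh}^{(m+1)h-1}\Big(\tfrac{b(k)}{a(k)}\,\mathbb E[\widehat{\mathcal L}(k)\mid\mathcal F(mh-1)]\otimes I_n+\mathbb E[\mathcal H^T(k)\mathcal H(k)\mid\mathcal F(mh-1)]\Big)\Big].$$ **Theorem.** Assume: 1. The sequence $\{v(k)\}$ is independent of the joint family $\{H(k)\},\{\mathcal A(k)\},\{\lambda_{ji}(k)\}$. 2. $\{v(k),\mathcal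 F(k)\}$ is a martingale difference sequence, and for some constant $\beta_v>0$, $\sup_{k\ge0}\mathbb E[\|v(k)\|^2\mid\mathcal F(k-1)]\le\beta_v$ a.s. 3. $\{a(k)\}$ and $\{b(k)\}$ are positive and decrease monotonically to $0$; $a(k)=O(b(k))$; $a(k)=O(a(k+p))$ for each positive integer $p$; $b^2(k)=o(a(k))$; and $\sum_k a(k)=\infty$. 4. There are a positive integer $h$ and constants $\theta,\rho_0>0$ such that (b.1) $\inf_{m\ge0}\lambda_m^h\ge\theta$ a.s.; (b.2) $\sup_{k\ge0}\Big[\mathbb E\big[(\|\mathcal L(k)\|+\|\mathcal H^T(k)\mathcal H(k)\|)^{2^{\max\{h,2\}}}\mid\mathcal F(k-1)\big]\Big]^{1/2^{\max\{h,2\}}}\le\rho_0$ a.s. 5. $\sup_{k\ge0}\|H(k)\|<\infty$ a.s. and $\sup_{k\ge0}\|\mathcal A(k)\|<\infty$ a.s. 6. $\sum_{k=0}^\infty b^2(k)<\infty$. Then, almost surely, $\lim_{k\to\infty}x_i(k)=x_0$ for every $i=1,\dots,N$. -/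

import Mathlib

open MeasureTheory ProbabilityTheory Filter Topology Asymptotics
open scoped Matrix Kronecker Matrix.Norms.L2Operator

noncomputable section

/-- The random data of a network of `N` estimators on the measurable space `Ω`: the observation
matrices `H_i(k)` (of size `m i × n`), the measurement noises `v_i(k)`, the weighted adjacency
matrices `[a_ij(k)]` of the communication graphs (real weights of either sign; `a_ij(k) ≠ 0` iff
there is a link from `j` to `i`) and the communication delays `delay k j i` on the link from `j`
to `i`, with values in `{0, …, d}`. -/
structure SensorNetwork (Ω : Type*) [MeasurableSpace Ω] (N n d : ℕ) (m : Fin N → ℕ) where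
  H : ℕ → (i : Fin N) → Ω → Matrix (Fin (m i)) (Fin n) ℝ
  v : ℕ → (i : Fin N) → Ω → Fin (m i) → ℝ
  adj : ℕ → Ω → Matrix (Fin N) (Fin N) ℝ
  delay : ℕ → Fin N → Fin N → Ω → Fin (d + 1)
  measurable_H : ∀ k i p c, Measurable fun ω => H k i ω p c
  measurable_v : ∀ k i, Measurable (v k i)
  measurable_adj : ∀ k i j, Measurable fun ω => adj k ω i j
  measurable_delay : ∀ k j i, Measurable (delay k j i)

/-- The smallest eigenvalue of a real symmetric matrix. -/
def lambdaMin {ι : Type*} [Fintype ι] [DecidableEq ι] (M : Matrix ι ι ℝ) : ℝ :=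
  sInf (spectrum ℝ M)

/-- Entrywise conditional expectation of a random matrix. -/
def condExpMatrix {Ω : Type*} {mΩ : MeasurableSpace Ω} (μ : Measure Ω) {ι κ : Type*}
    (𝓖 : MeasurableSpace Ω) (M : Ω → Matrix ι κ ℝ) (ω : Ω) : Matrix ι κ ℝ :=
  Matrix.of fun p q => (μ[fun ω' => M ω' p q | 𝓖]) ω

namespace SensorNetwork

variable {Ω : Type*} [MeasurableSpace Ω] {N n d : ℕ} {m : Fin N → ℕ}

/-- The stacked noise `v(k)`, with the Euclidean norm. -/
def noise (S : SensorNetwork Ω N n d m) (k : ℕ) (ω : Ω) :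
    EuclideanSpace ℝ (Σ i : Fin N, Fin (m i)) :=
  WithLp.toLp 2 fun p => S.v k p.1 ω p.2

/-- The stacked observation matrix `H(k) = [H_1(k)ᵀ, …, H_N(k)ᵀ]ᵀ`. -/
def stackedH (S : SensorNetwork Ω N n d m) (k : ℕ) (ω : Ω) :
    Matrix (Σ i : Fin N, Fin (m i)) (Fin n) ℝ :=
  Matrix.of fun p c => S.H k p.1 ω p.2 c

/-- The block diagonal matrix `diag(H_1(k), …, H_N(k))`. -/
def blockH (S : SensorNetwork Ω N n d m) (k : ℕ) (ω : Ω) :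
    Matrix (Σ i : Fin N, Fin (m i)) (Fin N × Fin n) ℝ :=
  Matrix.of fun p q => if p.1 = q.1 then S.H k p.1 ω p.2 q.2 else 0

/-- `blockH k ωᵀ * blockH k ω`. -/
def gram (S : SensorNetwork Ω N n d m) (k : ℕ) (ω : Ω) :
    Matrix (Fin N × Fin n) (Fin N × Fin n) ℝ :=
  (S.blockH k ω)ᵀ * S.blockH k ω

/-- The Laplacian matrix (degree matrix minus adjacency matrix), the degree of node `i` being
the sum of row `i` of the adjacency matrix. -/
def laplacian (S : SensorNetwork Ω N n d m) (k : ℕ) (ω : Ω) : Matrix (Fin N) (Fin N) ℝ :=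
  Matrix.diagonal (fun i => ∑ j, S.adj k ω i j) - S.adj k ω

/-- The symmetrized Laplacian. -/
def symLaplacian (S : SensorNetwork Ω N n d m) (k : ℕ) (ω : Ω) : Matrix (Fin N) (Fin N) ℝ :=
  (1 / 2 : ℝ) • (S.laplacian k ω + (S.laplacian k ω)ᵀ)

/-- The σ-algebra generated by the noises at time `k`. -/
abbrev noiseSigma (S : SensorNetwork Ω N n d m) (k : ℕ) : MeasurableSpace Ω :=
  ⨆ i, MeasurableSpace.comap (S.v k i) inferInstance

/-- The σ-algebra generated by the observation matrices, the adjacency matrix and the delays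
at time `k`. -/
abbrev modelSigma (S : SensorNetwork Ω N n d m) (k : ℕ) : MeasurableSpace Ω :=
  (⨆ i, ⨆ p, ⨆ c, MeasurableSpace.comap (fun ω => S.H k i ω p c) inferInstance) ⊔
    (⨆ i, ⨆ j, MeasurableSpace.comap (fun ω => S.adj k ω i j) inferInstance) ⊔
    ⨆ j, ⨆ i, MeasurableSpace.comap (S.delay k j i) inferInstance

/-- `S.past k` is the σ-algebra `𝓕(k - 1)` generated by all the data at the times `s < k`; in
particular `S.past 0 = 𝓕(-1)` is trivial. -/
abbrev past (S : SensorNetwork Ω N n d m) (k : ℕ) : MeasurableSpace Ω :=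
  ⨆ s, ⨆ _ : s < k, S.noiseSigma s ⊔ S.modelSigma s

/-- The measurement `z_i(k) = H_i(k) x₀ + v_i(k)`. -/
def measurement (S : SensorNetwork Ω N n d m) (x₀ : Fin n → ℝ) (k : ℕ) (i : Fin N) (ω : Ω) :
    Fin (m i) → ℝ :=
  S.H k i ω *ᵥ x₀ + S.v k i ω

open Classical in
/-- The neighbourhood of node `i` at time `k`. -/
def neighbors (S : SensorNetwork Ω N n d m) (k : ℕ) (i : Fin N) (ω : Ω) : Finset (Fin N) :=
  Finset.univ.filter fun j => S.adj k ω i j ≠ 0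

/-- The process `x` of estimates (`x t i` is the estimate of node `i` at time `t`) is produced by
the algorithm with innovation gain `a` and consensus gain `b` from the deterministic initial
estimates `ξ`. Values at negative times can only be called by delayed terms. -/
structure IsEstimate (S : SensorNetwork Ω N n d m) (x₀ : Fin n → ℝ) (a b : ℕ → ℝ)
    (ξ : Fin N → Fin n → ℝ) (x : ℤ → Fin N → Ω → Fin n → ℝ) : Prop where
  init : ∀ i ω, x 0 i ω = ξ i
  step : ∀ (k : ℕ) (i : Fin N) (ω : Ω),
    x ((k : ℤ) + 1) i ω = x k i ω
      + a k • ((S.H k i ω)ᵀ *ᵥ (S.measurement x₀ k i ω - S.H k i ω *ᵥ x k i ω))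
      + b k • ∑ j ∈ S.neighbors k i ω,
          S.adj k ω i j • (x ((k : ℤ) - ((S.delay k j i ω : ℕ) : ℤ)) j ω - x k i ω)

/-- No self-loops, almost surely. -/
def NoSelfLoops (S : SensorNetwork Ω N n d m) (μ : Measure Ω) : Prop :=
  ∀ k i, ∀ᵐ ω ∂μ, S.adj k ω i i = 0

/-- All delays vanish almost surely. -/
def DelayFree (S : SensorNetwork Ω N n d m) (μ : Measure Ω) : Prop :=
  ∀ k j i, ∀ᵐ ω ∂μ, S.delay k j i ω = 0

/-- The noise sequence is independent of the (joint) sequence of observation matrices, graphs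
and delays. -/
def NoiseIndep (S : SensorNetwork Ω N n d m) (μ : Measure Ω) : Prop :=
  Indep (⨆ k, S.noiseSigma k) (⨆ k, S.modelSigma k) μ

/-- The noise is a martingale difference sequence with respect to `𝓕(k)` (to which it is adapted
by construction) with conditional second moments bounded by a constant. -/
def NoiseMartingaleDifference (S : SensorNetwork Ω N n d m) (μ : Measure Ω) : Prop :=
  (∀ k, Integrable (S.noise k) μ ∧ μ[S.noise k | S.past k] =ᵐ[μ] 0) ∧
  ∃ β : ℝ, 0 < β ∧ ∀ k, Integrable (fun ω => ‖S.noise k ω‖ ^ 2) μ ∧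
    ∀ᵐ ω ∂μ, (μ[fun ω' => ‖S.noise k ω'‖ ^ 2 | S.past k]) ω ≤ β

/-- Almost sure boundedness of the observation matrices and of the adjacency matrices, in the
matrix 2-norm (the bound may depend on the sample path). -/
def BoundedPaths (S : SensorNetwork Ω N n d m) (μ : Measure Ω) : Prop :=
  (∀ᵐ ω ∂μ, BddAbove (Set.range fun k => ‖S.stackedH k ω‖)) ∧
  (∀ᵐ ω ∂μ, BddAbove (Set.range fun k => ‖S.adj k ω‖))

/-- The random variable `λ_j^h`: the smallest eigenvalue of the conditional expectation given
`𝓕(jh - 1)` of the information collected over the times `jh, …, (j+1)h - 1`. -/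
def excitation (S : SensorNetwork Ω N n d m) (μ : Measure Ω) (a b : ℕ → ℝ) (h j : ℕ) (ω : Ω) : ℝ :=
  lambdaMin (∑ k ∈ Finset.Ico (j * h) ((j + 1) * h),
    ((b k / a k) • (condExpMatrix μ (S.past (j * h)) (S.symLaplacian k) ω
        ⊗ₖ (1 : Matrix (Fin n) (Fin n) ℝ))
      + condExpMatrix μ (S.past (j * h)) (S.gram k) ω))

/-- Stochastic spatial-temporal persistence of excitation, with window `h` and level `θ`. -/
def PersistentlyExciting (S : SensorNetwork Ω N n d m) (μ : Measure Ω) (a b : ℕ → ℝ)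
    (h : ℕ) (θ : ℝ) : Prop :=
  ∀ᵐ ω ∂μ, ∀ j : ℕ, θ ≤ S.excitation μ a b h j ω

/-- Conditional moments of order `2 ^ max h 2` of `‖L(k)‖ + ‖𝓗(k)ᵀ 𝓗(k)‖` given the past,
bounded in normalized form by `ρ`. The integrability clause makes `μ[· | ·]` the actual
conditional expectation; it is necessary for the bound, since the variable is nonnegative. -/
def BoundedConditionalMoments (S : SensorNetwork Ω N n d m) (μ : Measure Ω) (h : ℕ) (ρ : ℝ) :
    Prop :=
  ∀ k : ℕ,
    Integrable (fun ω => (‖S.laplacian k ω‖ + ‖S.gram k ω‖) ^ (2 ^ max h 2)) μ ∧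
    ∀ᵐ ω ∂μ,
      ((μ[fun ω' => (‖S.laplacian k ω'‖ + ‖S.gram k ω'‖) ^ (2 ^ max h 2) | S.past k]) ω)
        ^ (1 / (2 : ℝ) ^ max h 2) ≤ ρ

end SensorNetwork

/-- The basic conditions on the innovation gain `a` and the consensus gain `b`. -/
structure GainCondition (a b : ℕ → ℝ) : Prop where
  a_pos : ∀ k, 0 < a k
  b_pos : ∀ k, 0 < b k
  a_anti : Antitone a
  b_anti : Antitone b
  a_lim : Tendsto a atTop (𝓝 0)
  b_lim : Tendsto b atTop (𝓝 0)
  a_isBigO_b : a =O[atTop] b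
  a_isBigO_shift : ∀ p : ℕ, 0 < p → a =O[atTop] fun k => a (k + p)
  b_sq_isLittleO : (fun k => b k ^ 2) =o[atTop] a
  a_sum : Tendsto (fun K => ∑ k ∈ Finset.range K, a k) atTop atTop

end

/-! Stack the errors `x_i(k) - x₀` into `e(k)`. Without delays, `e(k+1) = (I - D(k)) e(k) + a(k)
w(k)` with `D(k) = b(k) L(k) ⊗ I + a(k) 𝓗(k)ᵀ 𝓗(k)` and `w(k) = 𝓗(k)ᵀ v(k)`. The conditional mean of
`D(k)` at a single time need not be nonnegative: excitation acts only over a window of length `h`,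
given the past of its first instant `t = mh`.

So `‖e‖²` is followed through the window with `⟨e(k), D(k) e(k)⟩` replaced by `⟨e(t), D(k) e(t)⟩`.
Since `E‖e(k) - e(t)‖²` is at most a multiple of `b(t)² (E‖e(t)‖² + 1)`, the replacement costs only
second order in `b(t)` (`setIntegral_step_le`). The cross term with the noise vanishes: by
independence, `v(k)` is centred even given the whole model and the past noises
(`condExp_noise_eq_zero`).

Only the symmetric part of `L(k)` enters the quadratic form, so excitation bounds `∑ a(k)⁻¹ E⟨e(t),
D(k) e(t)⟩` over the window below by `θ E‖e(t)‖²` (`mul_setIntegral_le_sum_drift`). The weights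
`a(k)⁻¹` must then become `a(t)⁻¹`, although the single terms have no sign and are of size `b(k)
E‖e(t)‖²`. As `b = O(√a)` and `a(k) = O(a(k+h))`, the quantity `(a(t)/a(k) - 1) b(k)` is at most a
constant times `√a(t) - √a(t+h)`, which telescopes over the windows (`exists_ratio_sub_one_mul_le`).

Hence `V_m = ‖e(mh)‖²` satisfies `E[V_{m+1} | past] ≤ (1 + γ_m - 2θ a(mh)) V_m + γ_m` with `∑ γ_m <
∞` and `∑ a(mh) = ∞`, and a Robbins–Siegmund argument gives `V_m → 0` almost surely
(`ae_tendsto_zero_of_almost_supermartingale`). The increments inside the windows are summable in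
mean square, which extends the limit to all times. Conditional inequalities are kept in integrated
form, over the sets `A` of the relevant past. -/

noncomputable section

/-! ### Conditional expectations: bounded factors and independent enlargement -/

/-- Pulling out a nonnegative measurable factor under a bound on the conditional expectation. -/
theorem integrable_mul_and_integral_mul_le_of_condExp_le {Ω : Type*} {𝒢 mΩ : MeasurableSpace Ω}
    {μ : Measure Ω} [IsFiniteMeasure μ] (h𝒢 : 𝒢 ≤ mΩ) {f g : Ω → ℝ} {c : ℝ}
    (hf : StronglyMeasurable[𝒢] f) (hf0 : 0 ≤ f) (hfi : Integrable f μ)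
    (hg0 : 0 ≤ g) (hgi : Integrable g μ) (hc : ∀ᵐ ω ∂μ, (μ[g | 𝒢]) ω ≤ c) :
    Integrable (fun ω => f ω * g ω) μ ∧ ∫ ω, f ω * g ω ∂μ ≤ c * ∫ ω, f ω ∂μ := by
  have hgm : AEMeasurable (fun ω => ENNReal.ofReal (g ω)) μ := hgi.aemeasurable.ennreal_ofReal
  -- On `𝒢` the measure `g μ` is dominated by `c μ`: this is the conditional bound tested on sets.
  -- Integrating `f` against both measures works in `[0, ∞]`, so integrability of `f * g` is an
  -- outcome and not a premise.
  have hle : (μ.withDensity fun ω => ENNReal.ofReal (g ω)).trim h𝒢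
      ≤ (ENNReal.ofReal c • μ).trim h𝒢 := by
    refine Measure.le_iff.2 fun s hs => ?_
    rw [trim_measurableSet_eq h𝒢 hs, trim_measurableSet_eq h𝒢 hs,
      withDensity_apply _ (h𝒢 s hs), ← ofReal_integral_eq_lintegral_ofReal hgi.integrableOn
        (ae_of_all _ hg0), ← setIntegral_condExp h𝒢 hgi hs]
    have h1 : ∫ ω in s, (μ[g | 𝒢]) ω ∂μ ≤ ∫ _ in s, c ∂μ :=
      integral_mono_ae integrable_condExp.integrableOn (integrable_const _) (ae_restrict_of_ae hc)
    rw [setIntegral_const, smul_eq_mul] at h1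
    calc _ ≤ ENNReal.ofReal (μ.real s * c) := ENNReal.ofReal_le_ofReal h1
      _ = _ := by
        rw [ENNReal.ofReal_mul measureReal_nonneg, Measure.smul_apply, smul_eq_mul, mul_comm,
          ofReal_measureReal]
  have hfm : Measurable[𝒢] fun ω => ENNReal.ofReal (f ω) := hf.measurable.ennreal_ofReal
  have key : ∫⁻ ω, ENNReal.ofReal (f ω * g ω) ∂μ
      ≤ ENNReal.ofReal c * ENNReal.ofReal (∫ ω, f ω ∂μ) := by
    calc ∫⁻ ω, ENNReal.ofReal (f ω * g ω) ∂μ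
        = ∫⁻ ω, ENNReal.ofReal (f ω) ∂(μ.withDensity fun ω => ENNReal.ofReal (g ω)) := by
          rw [lintegral_withDensity_eq_lintegral_mul₀ hgm (hfm.mono h𝒢 le_rfl).aemeasurable]
          refine lintegral_congr fun ω => ?_
          simp only [Pi.mul_apply]
          rw [mul_comm (f ω), ENNReal.ofReal_mul (hg0 ω)]
      _ = ∫⁻ ω, ENNReal.ofReal (f ω)
            ∂((μ.withDensity fun ω => ENNReal.ofReal (g ω)).trim h𝒢) :=
          (lintegral_trim h𝒢 hfm).symm
      _ ≤ ∫⁻ ω, ENNReal.ofReal (f ω) ∂((ENNReal.ofReal c • μ).trim h𝒢) :=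
          lintegral_mono' hle le_rfl
      _ = ENNReal.ofReal c * ∫⁻ ω, ENNReal.ofReal (f ω) ∂μ := by
          rw [lintegral_trim h𝒢 hfm, lintegral_smul_measure, smul_eq_mul]
      _ = _ := by rw [ofReal_integral_eq_lintegral_ofReal hfi (ae_of_all _ hf0)]
  have hfg0 : 0 ≤ᵐ[μ] fun ω => f ω * g ω := ae_of_all _ fun ω => mul_nonneg (hf0 ω) (hg0 ω)
  have hfgm : AEStronglyMeasurable (fun ω => f ω * g ω) μ :=
    hfi.aestronglyMeasurable.mul hgi.aestronglyMeasurable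
  refine ⟨⟨hfgm, ?_⟩, ?_⟩
  · rw [hasFiniteIntegral_iff_ofReal hfg0]
    exact key.trans_lt (ENNReal.mul_lt_top ENNReal.ofReal_lt_top ENNReal.ofReal_lt_top)
  · have hF : 0 ≤ ∫ ω, f ω ∂μ := integral_nonneg hf0
    rcases isEmpty_or_nonempty Ω with hΩ | hΩ
    · simp [integral_eq_zero_of_ae (ae_of_all μ fun ω => (hΩ.false ω).elim)]
    by_cases hμ : μ = 0
    · simp [hμ]
    have hc0 : 0 ≤ c := by
      have : NeZero μ := ⟨hμ⟩
      have h1 : 0 ≤ᵐ[μ] μ[g | 𝒢] := condExp_nonneg (ae_of_all _ hg0)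
      obtain ⟨ω, h2, h3⟩ := (h1.and hc).exists
      exact le_trans h2 h3
    rw [integral_eq_lintegral_of_nonneg_ae hfg0 hfgm]
    refine ENNReal.toReal_le_of_le_ofReal (mul_nonneg hc0 hF) ?_
    rwa [ENNReal.ofReal_mul hc0]

/-- Enlarging the conditioning σ-algebra by an independent one does not change the conditional
expectation. -/
theorem condExp_sup_eq_of_indep {Ω : Type*} {𝒱 ℳ 𝒩 mΩ : MeasurableSpace Ω} {μ : Measure Ω}
    [IsProbabilityMeasure μ] (h𝒱 : 𝒱 ≤ mΩ) (hℳ : ℳ ≤ mΩ) (h𝒩 : 𝒩 ≤ 𝒱) (hind : Indep 𝒱 ℳ μ)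
    {f : Ω → ℝ} (hf : StronglyMeasurable[𝒱] f) (hfi : Integrable f μ) :
    μ[f | ℳ ⊔ 𝒩] =ᵐ[μ] μ[f | 𝒩] := by
  have hle : ℳ ⊔ 𝒩 ≤ mΩ := sup_le hℳ (h𝒩.trans h𝒱)
  -- Both `f` and its conditional expectation given `𝒩` are `𝒱`-measurable, so this factorization
  -- applies to each of them.
  have hprod : ∀ {g : Ω → ℝ}, StronglyMeasurable[𝒱] g → Integrable g μ → ∀ s t,
      MeasurableSet[ℳ] s → MeasurableSet[𝒩] t →
      ∫ ω in s ∩ t, g ω ∂μ = μ.real s * ∫ ω in t, g ω ∂μ := by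
    intro g hg hgi s t hs ht
    have ht' := h𝒩 t ht
    have h1 : μ[t.indicator g | ℳ] =ᵐ[μ] fun _ => μ[t.indicator g] :=
      condExp_indep_eq h𝒱 hℳ (hg.indicator ht') hind
    have h2 := setIntegral_condExp hℳ (hgi.indicator (h𝒱 t ht')) hs
    rw [integral_congr_ae (ae_restrict_of_ae h1), setIntegral_const, smul_eq_mul,
      integral_indicator (h𝒱 t ht'), setIntegral_indicator (h𝒱 t ht')] at h2
    exact h2.symm
  refine (ae_eq_condExp_of_forall_setIntegral_eq hle hfi
    (fun s _ _ => integrable_condExp.integrableOn) ?_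
    ⟨_, stronglyMeasurable_condExp.mono le_sup_right, EventuallyEq.rfl⟩).symm
  intro s hs _
  -- The intersections `s ∩ t` form a π-system generating `ℳ ⊔ 𝒩`; by `hprod` the two integrals
  -- agree on it as soon as they agree on `t ∈ 𝒩`.
  let C : Set (Set Ω) := {u | ∃ s t, MeasurableSet[ℳ] s ∧ MeasurableSet[𝒩] t ∧ u = s ∩ t}
  have hC : IsPiSystem C := by
    rintro _ ⟨s, t, hs, ht, rfl⟩ _ ⟨s', t', hs', ht', rfl⟩ _
    exact ⟨s ∩ s', t ∩ t', hs.inter hs', ht.inter ht', Set.inter_inter_inter_comm _ _ _ _⟩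
  have hgen : ℳ ⊔ 𝒩 = MeasurableSpace.generateFrom C := by
    apply le_antisymm
    · refine sup_le (fun s hs => ?_) fun t ht => ?_
      · exact MeasurableSpace.measurableSet_generateFrom
          ⟨s, Set.univ, hs, MeasurableSet.univ, (Set.inter_univ s).symm⟩
      · exact MeasurableSpace.measurableSet_generateFrom
          ⟨Set.univ, t, MeasurableSet.univ, ht, (Set.univ_inter t).symm⟩
    · refine MeasurableSpace.generateFrom_le ?_
      rintro _ ⟨s, t, hs, ht, rfl⟩
      exact MeasurableSet.inter ((le_sup_left : ℳ ≤ ℳ ⊔ 𝒩) s hs)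
        ((le_sup_right : 𝒩 ≤ ℳ ⊔ 𝒩) t ht)
  have htot : ∫ ω, (μ[f | 𝒩]) ω ∂μ = ∫ ω, f ω ∂μ := integral_condExp (h𝒩.trans h𝒱)
  refine MeasurableSpace.induction_on_inter (C := fun s _ =>
    ∫ ω in s, (μ[f | 𝒩]) ω ∂μ = ∫ ω in s, f ω ∂μ) hgen hC (by simp) ?_ ?_ ?_ s hs
  · rintro _ ⟨s, t, hs, ht, rfl⟩
    rw [hprod (stronglyMeasurable_condExp.mono h𝒩) integrable_condExp s t hs ht,
      hprod hf hfi s t hs ht, setIntegral_condExp (h𝒩.trans h𝒱) hfi ht]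
  · intro t ht h
    have h1 := integral_add_compl (hle t ht) hfi
    have h2 := integral_add_compl (hle t ht) (integrable_condExp (m := 𝒩) (μ := μ) (f := f))
    linarith
  · intro F hd hF h
    rw [integral_iUnion (fun i => hle _ (hF i)) hd integrable_condExp.integrableOn,
      integral_iUnion (fun i => hle _ (hF i)) hd hfi.integrableOn]
    exact tsum_congr h

/-! ### Almost supermartingales and elementary inequalities -/

/-- Convergence to zero of nonnegative almost supermartingales (Robbins–Siegmund), with
deterministic coefficients and the conditional inequality in integrated form. -/
theorem ae_tendsto_zero_of_almost_supermartingale {Ω : Type*} {mΩ : MeasurableSpace Ω}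
    {μ : Measure Ω} [IsProbabilityMeasure μ] (ℱ : Filtration ℕ mΩ) {V : ℕ → Ω → ℝ}
    {γ α : ℕ → ℝ} (hVm : ∀ m, StronglyMeasurable[ℱ m] (V m)) (hVi : ∀ m, Integrable (V m) μ)
    (hV0 : ∀ m ω, 0 ≤ V m ω) (hγ0 : ∀ m, 0 ≤ γ m) (hγ : Summable γ) (hα0 : ∀ m, 0 ≤ α m)
    (hα : Tendsto (fun K => ∑ m ∈ Finset.range K, α m) atTop atTop)
    (hstep : ∀ m A, MeasurableSet[ℱ m] A → ∫ ω in A, V (m + 1) ω ∂μ ≤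
      (1 + γ m) * ∫ ω in A, V m ω ∂μ - α m * ∫ ω in A, V m ω ∂μ + γ m * μ.real A) :
    (∀ᵐ ω ∂μ, Tendsto (fun m => V m ω) atTop (𝓝 0)) ∧ ∃ M, ∀ m, ∫ ω, V m ω ∂μ ≤ M := by
  -- Discount factors: dividing by `p m` removes the growth `1 + γ m`, and they stay bounded because
  -- `γ` is summable.
  let p : ℕ → ℝ := fun m => ∏ j ∈ Finset.range m, (1 + γ j)
  have hp_succ : ∀ m, p (m + 1) = p m * (1 + γ m) := fun m => Finset.prod_range_succ _ _
  have hp_mono : Monotone p := by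
    refine monotone_nat_of_le_succ fun m => ?_
    rw [hp_succ]
    exact le_mul_of_one_le_right (Finset.prod_nonneg fun j _ => by linarith [hγ0 j])
      (by linarith [hγ0 m])
  have hp1 : ∀ m, 1 ≤ p m := fun m => by simpa [p] using hp_mono (Nat.zero_le m)
  obtain ⟨P, hP⟩ : ∃ P, ∀ m, p m ≤ P := ⟨Real.exp (∑' j, γ j), fun m =>
    (Real.prod_one_add_le_exp_sum _ fun j => hγ0 j).trans
      (Real.exp_le_exp.2 (hγ.sum_le_tsum _ fun j _ => hγ0 j))⟩
  have hP1 : 1 ≤ P := (hp1 0).trans (hP 0)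
  have hp_lim : Tendsto p atTop (𝓝 (⨆ m, p m)) :=
    tendsto_atTop_ciSup hp_mono ⟨P, by rintro _ ⟨m, rfl⟩; exact hP m⟩
  -- The added `1` absorbs the additive error: `(1 + γ) V + γ + 1 = (1 + γ) (V + 1)`.
  let Z : ℕ → Ω → ℝ := fun m ω => (V m ω + 1) / p m
  have hZ0 : ∀ m ω, 0 ≤ Z m ω := fun m ω =>
    div_nonneg (by linarith [hV0 m ω]) (by linarith [hp1 m])
  have hZi : ∀ m, Integrable (Z m) μ := fun m => ((hVi m).add (integrable_const 1)).div_const _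
  have hZA : ∀ m A, ∫ ω in A, Z m ω ∂μ = (∫ ω in A, V m ω ∂μ + μ.real A) / p m := by
    intro m A
    simp only [Z]
    rw [integral_div, integral_add (hVi m).integrableOn (integrable_const 1)]
    simp
  have hVA : ∀ m A, 0 ≤ ∫ ω in A, V m ω ∂μ := fun m A => integral_nonneg (hV0 m)
  have hZstep : ∀ m A, MeasurableSet[ℱ m] A → ∫ ω in A, Z (m + 1) ω ∂μ ≤
      ∫ ω in A, Z m ω ∂μ - α m * (∫ ω in A, V m ω ∂μ) / P := by
    intro m A hA
    have hpm : 0 < p m := by linarith [hp1 m]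
    have hpm' : 0 < p (m + 1) := by linarith [hp1 (m + 1)]
    have h1 := hstep m A hA
    have h2 : α m * (∫ ω in A, V m ω ∂μ) / P ≤ α m * (∫ ω in A, V m ω ∂μ) / p (m + 1) :=
      div_le_div_of_nonneg_left (mul_nonneg (hα0 m) (hVA m A)) hpm' (hP _)
    rw [hZA, hZA]
    have h3 : (∫ ω in A, V m ω ∂μ + μ.real A) / p m
        = ((1 + γ m) * (∫ ω in A, V m ω ∂μ + μ.real A)) / p (m + 1) := by
      rw [hp_succ, mul_comm (p m), mul_div_mul_left _ _ (by linarith [hγ0 m])]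
    have h4 : (∫ ω in A, V (m + 1) ω ∂μ + μ.real A) / p (m + 1) ≤
        ((1 + γ m) * (∫ ω in A, V m ω ∂μ + μ.real A) - α m * (∫ ω in A, V m ω ∂μ)) / p (m + 1) :=
      div_le_div_of_nonneg_right (by linarith) hpm'.le
    rw [sub_div] at h4
    linarith
  have hZsup : Supermartingale Z ℱ μ := by
    refine supermartingale_of_setIntegral_succ_le (fun m => ?_) hZi fun m A hA =>
      (hZstep m A hA).trans ?_
    · exact ((hVm m).add stronglyMeasurable_const).div stronglyMeasurable_const
    · linarith [div_nonneg (mul_nonneg (hα0 m) (hVA m A)) (zero_le_one.trans hP1)]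
  have hZint : ∀ m, ∫ ω, Z (m + 1) ω ∂μ ≤ ∫ ω, Z m ω ∂μ - α m * (∫ ω, V m ω ∂μ) / P := by
    intro m
    simpa using hZstep m Set.univ MeasurableSet.univ
  have hVint : ∀ m, 0 ≤ ∫ ω, V m ω ∂μ := fun m => integral_nonneg (hV0 m)
  have hZint0 : ∀ m, 0 ≤ ∫ ω, Z m ω ∂μ := fun m => integral_nonneg (hZ0 m)
  have hsum : ∀ K, ∫ ω, Z K ω ∂μ + (∑ m ∈ Finset.range K, α m * ∫ ω, V m ω ∂μ) / P
      ≤ ∫ ω, Z 0 ω ∂μ := by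
    intro K
    induction K with
    | zero => simp
    | succ K ih =>
      rw [Finset.sum_range_succ, add_div]
      linarith [hZint K]
  have hZle : ∀ m, ∫ ω, Z m ω ∂μ ≤ ∫ ω, Z 0 ω ∂μ := fun m => by
    have : 0 ≤ (∑ m ∈ Finset.range m, α m * ∫ ω, V m ω ∂μ) / P :=
      div_nonneg (Finset.sum_nonneg fun j _ => mul_nonneg (hα0 j) (hVint j))
        (zero_le_one.trans hP1)
    linarith [hsum m]
  refine ⟨?_, P * ∫ ω, Z 0 ω ∂μ, fun m => ?_⟩
  swap
  · have h1 : ∫ ω, V m ω ∂μ ≤ p m * ∫ ω, Z m ω ∂μ := by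
      have hpm : 0 < p m := by linarith [hp1 m]
      have h := hZA m Set.univ
      simp only [setIntegral_univ] at h
      rw [h, mul_div_cancel₀ _ hpm.ne']
      linarith [measureReal_nonneg (μ := μ) (s := Set.univ)]
    calc _ ≤ p m * ∫ ω, Z m ω ∂μ := h1
      _ ≤ P * ∫ ω, Z 0 ω ∂μ :=
        mul_le_mul (hP m) (hZle m) (hZint0 m) (zero_le_one.trans hP1)
  have hconv : ∀ᵐ ω ∂μ, ∃ c, Tendsto (fun m => V m ω) atTop (𝓝 c) := by
    have h1 : ∀ m, eLpNorm ((-Z) m) 1 μ ≤ (∫ ω, Z 0 ω ∂μ).toNNReal := by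
      intro m
      rw [Pi.neg_apply, eLpNorm_neg, eLpNorm_one_eq_lintegral_enorm,
        ← ofReal_integral_norm_eq_lintegral_enorm (hZi m)]
      simp_rw [Real.norm_of_nonneg (hZ0 m _)]
      exact ENNReal.ofReal_le_ofReal (hZle m)
    filter_upwards [hZsup.neg.exists_ae_tendsto_of_bdd h1] with ω ⟨c, hc⟩
    refine ⟨-c * (⨆ m, p m) - 1, ?_⟩
    have h2 := (hc.neg.mul hp_lim).sub_const 1
    refine h2.congr fun m => ?_
    have hpm : p m ≠ 0 := by linarith [hp1 m]
    simp [Z, hpm]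
  -- Telescoping bounds `∑ α m * E V m`, while `∑ α m` diverges, so `E V m` cannot stay above `ε`.
  have hfreq : ∀ ε > 0, ∃ᶠ m in atTop, ∫ ω, V m ω ∂μ ≤ ε := by
    intro ε hε hev
    simp only [not_le] at hev
    obtain ⟨K₀, hK₀⟩ := eventually_atTop.1 hev
    have h1 : ∀ K ≥ K₀, ε * (∑ m ∈ Finset.range K, α m - ∑ m ∈ Finset.range K₀, α m)
        ≤ ∑ m ∈ Finset.range K, α m * ∫ ω, V m ω ∂μ := by
      intro K hK
      rw [← Finset.sum_Ico_eq_sub _ hK, Finset.mul_sum]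
      calc ∑ m ∈ Finset.Ico K₀ K, ε * α m
          ≤ ∑ m ∈ Finset.Ico K₀ K, α m * ∫ ω, V m ω ∂μ := by
            refine Finset.sum_le_sum fun m hm => ?_
            rw [mul_comm]
            exact mul_le_mul_of_nonneg_left (hK₀ m (Finset.mem_Ico.1 hm).1).le (hα0 m)
        _ ≤ _ := Finset.sum_le_sum_of_subset_of_nonneg
            (fun m hm => Finset.mem_range.2 (Finset.mem_Ico.1 hm).2)
            fun m _ _ => mul_nonneg (hα0 m) (hVint m)
    obtain ⟨K, hK, hK'⟩ := ((eventually_ge_atTop K₀).and (hα.eventually_gt_atTop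
      (∑ m ∈ Finset.range K₀, α m + P * (∫ ω, Z 0 ω ∂μ) / ε))).exists
    have h2 := hsum K
    have h3 : ∑ m ∈ Finset.range K, α m * ∫ ω, V m ω ∂μ ≤ P * ∫ ω, Z 0 ω ∂μ := by
      have h4 := hZint0 K
      have : (∑ m ∈ Finset.range K, α m * ∫ ω, V m ω ∂μ) / P ≤ ∫ ω, Z 0 ω ∂μ := by linarith
      rwa [div_le_iff₀ (by linarith), mul_comm] at this
    have h5 := h1 K hK
    have h6 : P * (∫ ω, Z 0 ω ∂μ) / ε
        < ∑ m ∈ Finset.range K, α m - ∑ m ∈ Finset.range K₀, α m := by linarith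
    rw [div_lt_iff₀ hε] at h6
    linarith
  -- Fatou's lemma. A limit of `V m` exists almost everywhere by supermartingale convergence, so a
  -- vanishing lower limit identifies it as zero.
  have hliminf : ∫⁻ ω, liminf (fun m => ENNReal.ofReal (V m ω)) atTop ∂μ = 0 := by
    refine le_antisymm (le_trans (lintegral_liminf_le'
      fun m => (hVi m).aemeasurable.ennreal_ofReal) ?_) bot_le
    refine ENNReal.le_of_forall_pos_le_add fun ε hε _ => ?_
    rw [zero_add]
    refine liminf_le_of_frequently_le' ((hfreq ε hε).mono fun m hm => ?_)
    rw [← ofReal_integral_eq_lintegral_ofReal (hVi m) (ae_of_all _ (hV0 m))]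
    exact (ENNReal.ofReal_le_ofReal hm).trans_eq (ENNReal.ofReal_coe_nnreal)
  rw [lintegral_eq_zero_iff
    (.liminf fun m => ((hVm m).mono (ℱ.le m)).measurable.ennreal_ofReal)] at hliminf
  filter_upwards [hconv, hliminf] with ω ⟨c, hc⟩ h0
  have h1 := (ENNReal.tendsto_ofReal hc).liminf_eq
  rw [h0, Pi.zero_apply, eq_comm, ENNReal.ofReal_eq_zero] at h1
  rwa [le_antisymm h1 (ge_of_tendsto' hc fun m => hV0 m ω)] at hc

/-- By Tonelli the series `∑ f m` has finite integral, so it is finite almost everywhere and its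
terms tend to zero. -/
theorem ae_tendsto_zero_of_summable_integral {Ω : Type*} {mΩ : MeasurableSpace Ω}
    {μ : Measure Ω} {f : ℕ → Ω → ℝ} {g : ℕ → ℝ} (hf0 : ∀ m ω, 0 ≤ f m ω)
    (hfi : ∀ m, Integrable (f m) μ) (hfg : ∀ m, ∫ ω, f m ω ∂μ ≤ g m) (hg : Summable g) :
    ∀ᵐ ω ∂μ, Tendsto (fun m => f m ω) atTop (𝓝 0) := by
  have h1 : ∫⁻ ω, ∑' m, ENNReal.ofReal (f m ω) ∂μ ≠ ⊤ := by
    rw [lintegral_tsum fun m => (hfi m).aemeasurable.ennreal_ofReal]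
    refine ne_top_of_le_ne_top hg.tsum_ofReal_ne_top (ENNReal.tsum_le_tsum fun m => ?_)
    rw [← ofReal_integral_eq_lintegral_ofReal (hfi m) (ae_of_all _ (hf0 m))]
    exact ENNReal.ofReal_le_ofReal (hfg m)
  filter_upwards [ae_lt_top' (AEMeasurable.tsum fun m =>
    (hfi m).aemeasurable.ennreal_ofReal) h1] with ω hω
  have h2 := ENNReal.tendsto_atTop_zero_of_tsum_ne_top hω.ne
  have h3 := (ENNReal.tendsto_toReal ENNReal.zero_ne_top).comp h2
  exact h3.congr fun m => ENNReal.toReal_ofReal (hf0 m ω)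

theorem sq_le_one_add_pow {z : ℝ} (hz : 0 ≤ z) {q : ℕ} (hq : 2 ≤ q) : z ^ 2 ≤ 1 + z ^ q := by
  rcases le_total z 1 with h | h
  · linarith [pow_le_one₀ (n := 2) hz h, pow_nonneg hz q]
  · linarith [pow_le_pow_right₀ h hq]

theorem norm_add_add_sq_le {E : Type*} [SeminormedAddCommGroup E] (x y z : E) :
    ‖x + y + z‖ ^ 2 ≤ 3 * ‖x‖ ^ 2 + 3 * ‖y‖ ^ 2 + 3 * ‖z‖ ^ 2 := by
  have h := norm_add₃_le (a := x) (b := y) (c := z)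
  nlinarith [sq_nonneg (‖x‖ - ‖y‖), sq_nonneg (‖x‖ - ‖z‖), sq_nonneg (‖y‖ - ‖z‖),
    norm_nonneg (x + y + z), norm_nonneg x, norm_nonneg y, norm_nonneg z]

theorem norm_sq_le_two_mul_sub {E : Type*} [SeminormedAddCommGroup E] (x y : E) :
    ‖x‖ ^ 2 ≤ 2 * ‖y‖ ^ 2 + 2 * ‖x - y‖ ^ 2 := by
  have h := norm_le_norm_add_norm_sub y x
  rw [norm_sub_rev] at h
  nlinarith [sq_nonneg (‖y‖ - ‖x - y‖), norm_nonneg x, norm_nonneg y, norm_nonneg (x - y)]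

/-! ### Mean-square estimates for a linear recursion with random operators -/

/-- The recursion `e (k + 1) = e k - D k (e k) + a k • w k` with random operators `D k` of size
`b k * Y k`, where `Y k` has bounded conditional second moments, and with noise `w k` that is
conditionally square integrable and orthogonal to `e k - D k (e k)`. -/
structure RandomLinearRecursion {Ω E : Type*} {mΩ : MeasurableSpace Ω} [NormedAddCommGroup E]
    [InnerProductSpace ℝ E] (μ : Measure Ω) (ℱ : Filtration ℕ mΩ) (a b : ℕ → ℝ)
    (e : ℕ → Ω → E) (D : ℕ → Ω → E →L[ℝ] E) (w : ℕ → Ω → E) (Y : ℕ → Ω → ℝ) (ρ K : ℝ) :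
    Prop where
  integrable_init : Integrable (fun ω => ‖e 0 ω‖ ^ 2) μ
  step : ∀ k ω, e (k + 1) ω = e k ω - D k ω (e k ω) + a k • w k ω
  measurable_e : ∀ k, StronglyMeasurable[ℱ k] (e k)
  measurable_D : ∀ k, StronglyMeasurable (D k)
  measurable_w : ∀ k, StronglyMeasurable (w k)
  norm_D_le : ∀ k ω, ‖D k ω‖ ≤ b k * Y k ω
  one_le_Y : ∀ k ω, 1 ≤ Y k ω
  integrable_Y : ∀ k, Integrable (fun ω => Y k ω ^ 2) μ
  condExp_Y : ∀ k, ∀ᵐ ω ∂μ, (μ[fun ω => Y k ω ^ 2 | ℱ k]) ω ≤ ρ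
  integrable_w : ∀ k, Integrable (fun ω => ‖w k ω‖ ^ 2) μ
  integral_w : ∀ k A, MeasurableSet[ℱ k] A → ∫ ω in A, ‖w k ω‖ ^ 2 ∂μ ≤ K * μ.real A
  -- The integrability premise avoids a circle: orthogonality is proved from it, and `integrable_sq`
  -- derives it from the other fields.
  orthogonal : ∀ k, Integrable (fun ω => ‖e k ω‖ ^ 2) μ → ∀ A, MeasurableSet[ℱ k] A →
    ∫ ω in A, inner ℝ (e k ω - D k ω (e k ω)) (w k ω) ∂μ = 0
  ρ_nonneg : 0 ≤ ρ
  K_nonneg : 0 ≤ K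
  b_pos : ∀ k, 0 < b k

namespace RandomLinearRecursion

variable {Ω E : Type*} {mΩ : MeasurableSpace Ω} [NormedAddCommGroup E] [InnerProductSpace ℝ E]
  {μ : Measure Ω} {ℱ : Filtration ℕ mΩ} {a b : ℕ → ℝ}
  {e : ℕ → Ω → E} {D : ℕ → Ω → E →L[ℝ] E} {w : ℕ → Ω → E} {Y : ℕ → Ω → ℝ} {ρ K : ℝ}

theorem stronglyMeasurable_e (R : RandomLinearRecursion μ ℱ a b e D w Y ρ K) (k : ℕ) :
    StronglyMeasurable (e k) :=
  (R.measurable_e k).mono (ℱ.le k)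

theorem stronglyMeasurable_apply (R : RandomLinearRecursion μ ℱ a b e D w Y ρ K) (k : ℕ)
    {f : Ω → E} (hf : StronglyMeasurable f) : StronglyMeasurable fun ω => D k ω (f ω) :=
  isBoundedBilinearMap_apply.continuous.comp_stronglyMeasurable ((R.measurable_D k).prodMk hf)

theorem norm_apply_sq_le (R : RandomLinearRecursion μ ℱ a b e D w Y ρ K) (k : ℕ) (ω : Ω) (x : E) :
    ‖D k ω x‖ ^ 2 ≤ b k ^ 2 * (‖x‖ ^ 2 * Y k ω ^ 2) := by
  have h : ‖D k ω x‖ ≤ b k * Y k ω * ‖x‖ :=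
    (D k ω).le_of_opNorm_le (R.norm_D_le k ω) x
  calc ‖D k ω x‖ ^ 2 ≤ (b k * Y k ω * ‖x‖) ^ 2 := pow_le_pow_left₀ (norm_nonneg _) h 2
    _ = _ := by ring

theorem abs_inner_apply_le (R : RandomLinearRecursion μ ℱ a b e D w Y ρ K) (k : ℕ) (ω : Ω) (x : E) :
    |inner ℝ x (D k ω x)| ≤ b k * (‖x‖ ^ 2 * Y k ω ^ 2) := by
  have h1 := R.one_le_Y k ω
  have hb := (R.b_pos k).le
  calc |inner ℝ x (D k ω x)| ≤ ‖x‖ * ‖D k ω x‖ := abs_real_inner_le_norm _ _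
    _ ≤ ‖x‖ * (b k * Y k ω * ‖x‖) := by
      gcongr
      exact (D k ω).le_of_opNorm_le (R.norm_D_le k ω) _
    _ = b k * (‖x‖ ^ 2 * Y k ω) := by ring
    _ ≤ b k * (‖x‖ ^ 2 * Y k ω ^ 2) := by
      gcongr
      nlinarith

theorem measurable_norm_sq (R : RandomLinearRecursion μ ℱ a b e D w Y ρ K) {t k : ℕ} (htk : t ≤ k) :
    StronglyMeasurable[ℱ k] fun ω => ‖e t ω‖ ^ 2 :=
  ((R.measurable_e t).mono (ℱ.mono htk)).norm.pow 2

theorem norm_step_sub_sq_le (R : RandomLinearRecursion μ ℱ a b e D w Y ρ K) (k : ℕ) (ω : Ω)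
    (x : E) : ‖e (k + 1) ω - x‖ ^ 2 ≤ 3 * ‖e k ω - x‖ ^ 2
      + 3 * (b k ^ 2 * (‖e k ω‖ ^ 2 * Y k ω ^ 2)) + 3 * (a k ^ 2 * ‖w k ω‖ ^ 2) := by
  have h := norm_add_add_sq_le (e k ω - x) (-(D k ω (e k ω))) (a k • w k ω)
  have h1 : e (k + 1) ω - x = e k ω - x + -(D k ω (e k ω)) + a k • w k ω := by
    rw [R.step]; abel
  rw [← h1, norm_neg, norm_smul, mul_pow, Real.norm_eq_abs, sq_abs] at h
  linarith [R.norm_apply_sq_le k ω (e k ω)]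

/-- Expand the square and move the form `⟨e k, D k (e k)⟩` to a reference vector `x`, in the
application the error at the start of the window. The mixed terms carry `b k * ‖e k - x‖`; Young's
inequality splits them into `‖e k - x‖ ^ 2` and `b k ^ 2` times squared norms, both of second order.
Since `1 ≤ Y k`, everything can be collected in front of `Y k ^ 2`, the factor whose conditional
mean is bounded. -/
theorem norm_step_sq_le (R : RandomLinearRecursion μ ℱ a b e D w Y ρ K) (k : ℕ) (ω : Ω)
    (x : E) : ‖e (k + 1) ω‖ ^ 2 ≤ ‖e k ω‖ ^ 2 - 2 * inner ℝ x (D k ω x)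
      + (‖e k ω - x‖ ^ 2 + 3 * b k ^ 2 * ‖e k ω‖ ^ 2 + 2 * b k ^ 2 * ‖x‖ ^ 2) * Y k ω ^ 2
      + 2 * a k * inner ℝ (e k ω - D k ω (e k ω)) (w k ω) + a k ^ 2 * ‖w k ω‖ ^ 2 := by
  set y := e k ω
  set δ := y - x with hδ
  have hY := R.one_le_Y k ω
  have hb := (R.b_pos k).le
  have h1 : ‖e (k + 1) ω‖ ^ 2 = ‖y‖ ^ 2 - 2 * inner ℝ y (D k ω y) + ‖D k ω y‖ ^ 2
      + 2 * a k * inner ℝ (y - D k ω y) (w k ω) + a k ^ 2 * ‖w k ω‖ ^ 2 := by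
    rw [R.step, norm_add_sq_real, norm_sub_sq_real, inner_smul_right, norm_smul, mul_pow,
      Real.norm_eq_abs, sq_abs]
    ring
  have h2 : inner ℝ y (D k ω y)
      = inner ℝ x (D k ω x) + (inner ℝ δ (D k ω y) + inner ℝ x (D k ω δ)) := by
    rw [hδ, map_sub, inner_sub_left, inner_sub_right]
    ring
  have hop : ∀ u v : E, -(inner ℝ u (D k ω v)) ≤ b k * Y k ω * (‖u‖ * ‖v‖) := fun u v => by
    calc -(inner ℝ u (D k ω v)) ≤ |inner ℝ u (D k ω v)| := neg_le_abs _
      _ ≤ ‖u‖ * ‖D k ω v‖ := abs_real_inner_le_norm _ _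
      _ ≤ ‖u‖ * (b k * Y k ω * ‖v‖) := by
        gcongr
        exact (D k ω).le_of_opNorm_le (R.norm_D_le k ω) v
      _ = _ := by ring
  have h3 := hop δ y
  have h4 := hop x δ
  have h5 := R.norm_apply_sq_le k ω y
  have h6 : 2 * (b k * Y k ω * (‖δ‖ * ‖y‖)) + 2 * (b k * Y k ω * (‖x‖ * ‖δ‖)) ≤
      (‖δ‖ ^ 2 + 2 * b k ^ 2 * ‖y‖ ^ 2 + 2 * b k ^ 2 * ‖x‖ ^ 2) * Y k ω ^ 2 := by
    have h7 : 2 * (b k * (‖δ‖ * ‖y‖)) + 2 * (b k * (‖x‖ * ‖δ‖)) ≤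
        ‖δ‖ ^ 2 + 2 * b k ^ 2 * ‖y‖ ^ 2 + 2 * b k ^ 2 * ‖x‖ ^ 2 := by
      nlinarith [sq_nonneg (‖δ‖ - b k * (‖y‖ + ‖x‖)), sq_nonneg (b k * (‖y‖ - ‖x‖))]
    have h8 : Y k ω ≤ Y k ω ^ 2 := by nlinarith
    calc _ = (2 * (b k * (‖δ‖ * ‖y‖)) + 2 * (b k * (‖x‖ * ‖δ‖))) * Y k ω := by ring
      _ ≤ _ := mul_le_mul h7 h8 (by linarith) (by positivity)
  linarith

variable [IsProbabilityMeasure μ]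

theorem integrable_mul_Y (R : RandomLinearRecursion μ ℱ a b e D w Y ρ K) {k : ℕ} {f : Ω → ℝ}
    (hf : StronglyMeasurable[ℱ k] f) (hf0 : 0 ≤ f) (hfi : Integrable f μ) :
    Integrable (fun ω => f ω * Y k ω ^ 2) μ :=
  (integrable_mul_and_integral_mul_le_of_condExp_le (ℱ.le k) hf hf0 hfi
    (fun ω => sq_nonneg (Y k ω)) (R.integrable_Y k) (R.condExp_Y k)).1

theorem setIntegral_mul_Y_le (R : RandomLinearRecursion μ ℱ a b e D w Y ρ K) {k : ℕ} {f : Ω → ℝ}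
    (hf : StronglyMeasurable[ℱ k] f) (hf0 : 0 ≤ f) (hfi : Integrable f μ) {A : Set Ω}
    (hA : MeasurableSet[ℱ k] A) :
    ∫ ω in A, f ω * Y k ω ^ 2 ∂μ ≤ ρ * ∫ ω in A, f ω ∂μ := by
  have hA' := ℱ.le k A hA
  have h := (integrable_mul_and_integral_mul_le_of_condExp_le (ℱ.le k) (hf.indicator hA)
    (Set.indicator_nonneg fun ω _ => hf0 ω) (hfi.indicator hA')
    (fun ω => sq_nonneg (Y k ω)) (R.integrable_Y k) (R.condExp_Y k)).2
  rw [integral_indicator hA'] at h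
  rw [← integral_indicator hA']
  refine le_trans (le_of_eq (integral_congr_ae (ae_of_all _ fun ω => ?_))) h
  by_cases hω : ω ∈ A <;> simp [hω]

/-- `e k` is determined by the past, so the conditional bound on `Y k ^ 2` makes `‖e k‖ ^ 2 * Y k ^
2` integrable although the factors may be dependent. -/
theorem integrable_sq (R : RandomLinearRecursion μ ℱ a b e D w Y ρ K) (k : ℕ) :
    Integrable (fun ω => ‖e k ω‖ ^ 2) μ := by
  induction k with
  | zero => exact R.integrable_init
  | succ k ih =>
    have h1 := R.integrable_mul_Y (R.measurable_norm_sq le_rfl) (fun ω => sq_nonneg _) ih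
    refine Integrable.mono' (((ih.const_mul 3).add ((h1.const_mul (b k ^ 2)).const_mul 3)).add
      (((R.integrable_w k).const_mul (a k ^ 2)).const_mul 3))
      ((R.stronglyMeasurable_e (k + 1)).norm.pow 2).aestronglyMeasurable (ae_of_all _ fun ω => ?_)
    rw [Real.norm_of_nonneg (sq_nonneg _)]
    simpa using R.norm_step_sub_sq_le k ω 0

theorem integrable_sub_sq (R : RandomLinearRecursion μ ℱ a b e D w Y ρ K) (k l : ℕ) :
    Integrable (fun ω => ‖e k ω - e l ω‖ ^ 2) μ := by
  refine Integrable.mono' (((R.integrable_sq k).const_mul 2).add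
    ((R.integrable_sq l).const_mul 2))
    (((R.stronglyMeasurable_e k).sub (R.stronglyMeasurable_e l)).norm.pow 2).aestronglyMeasurable
    (ae_of_all _ fun ω => ?_)
  rw [Real.norm_of_nonneg (sq_nonneg _)]
  have h := norm_sub_le (e k ω) (e l ω)
  simp only [Pi.add_apply]
  nlinarith [sq_nonneg (‖e k ω‖ - ‖e l ω‖), norm_nonneg (e k ω - e l ω)]

theorem setIntegral_le_two_mul (R : RandomLinearRecursion μ ℱ a b e D w Y ρ K) (k l : ℕ)
    (A : Set Ω) : ∫ ω in A, ‖e k ω‖ ^ 2 ∂μ ≤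
      2 * ∫ ω in A, ‖e l ω‖ ^ 2 ∂μ + 2 * ∫ ω in A, ‖e k ω - e l ω‖ ^ 2 ∂μ := by
  have h1 := ((R.integrable_sq l).const_mul 2).integrableOn (s := A)
  have h2 := ((R.integrable_sub_sq k l).const_mul 2).integrableOn (s := A)
  rw [← integral_const_mul, ← integral_const_mul, ← integral_add h1 h2]
  exact integral_mono (R.integrable_sq k).integrableOn (h1.add h2)
    fun ω => norm_sq_le_two_mul_sub _ _

/-- Each step moves the error by `D e`, of size `b * Y * ‖e‖`, and by `a • w` with `a ≤ C * b`;
finitely many such moves remain of order `b t`. -/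
theorem setIntegral_sub_sq_le (R : RandomLinearRecursion μ ℱ a b e D w Y ρ K)
    (hb : Antitone b) {C : ℝ} (hC : 0 ≤ C) (ha0 : ∀ k, 0 ≤ a k) (hab : ∀ k, a k ≤ C * b k) (j : ℕ) :
    ∃ c, 0 ≤ c ∧ ∀ t A, MeasurableSet[ℱ t] A → ∫ ω in A, ‖e (t + j) ω - e t ω‖ ^ 2 ∂μ ≤
      c * b t ^ 2 * (∫ ω in A, ‖e t ω‖ ^ 2 ∂μ + μ.real A) := by
  induction j with
  | zero => exact ⟨0, le_rfl, fun t A _ => by simp⟩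
  | succ j ih =>
    obtain ⟨c, hc, ih⟩ := ih
    -- The factors `3` come from squaring a sum of three terms, `2 + 2 * c * b 0 ^ 2` bounds `‖e (t
    -- + j)‖ ^ 2` through `‖e t‖ ^ 2` and the increment (`h6`), and `C ^ 2 * K` bounds the noise.
    refine ⟨3 * c + 3 * ρ * (2 + 2 * c * b 0 ^ 2) + 3 * (C ^ 2 * K), ?_, fun t A hA => ?_⟩
    · have := R.ρ_nonneg
      have := R.K_nonneg
      positivity
    have hA' := ℱ.mono (Nat.le_add_right t j) A hA
    set V := ∫ ω in A, ‖e t ω‖ ^ 2 ∂μ with hV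
    have hV0 : 0 ≤ V := integral_nonneg fun ω => sq_nonneg _
    have hμ0 : 0 ≤ μ.real A := measureReal_nonneg
    have hsq := R.integrable_sq (t + j)
    have hm := R.measurable_norm_sq (le_refl (t + j))
    have i1 := ((R.integrable_sub_sq (t + j) t).const_mul 3).integrableOn (s := A)
    have i2 := (((R.integrable_mul_Y hm (fun ω => sq_nonneg _) hsq).const_mul
      (b (t + j) ^ 2)).const_mul 3).integrableOn (s := A)
    have i3 := (((R.integrable_w (t + j)).const_mul (a (t + j) ^ 2)).const_mul 3).integrableOn
      (s := A)
    have h1 : ∫ ω in A, ‖e (t + (j + 1)) ω - e t ω‖ ^ 2 ∂μ ≤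
        3 * ∫ ω in A, ‖e (t + j) ω - e t ω‖ ^ 2 ∂μ
        + 3 * (b (t + j) ^ 2 * ∫ ω in A, ‖e (t + j) ω‖ ^ 2 * Y (t + j) ω ^ 2 ∂μ)
        + 3 * (a (t + j) ^ 2 * ∫ ω in A, ‖w (t + j) ω‖ ^ 2 ∂μ) := by
      refine (integral_mono (R.integrable_sub_sq _ _).integrableOn ((i1.add i2).add i3)
        fun ω => R.norm_step_sub_sq_le (t + j) ω (e t ω)).trans_eq ?_
      simp only [← integral_const_mul]
      rw [integral_add' (i1.add i2) i3, integral_add' i1 i2]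
    have h2 := R.setIntegral_mul_Y_le hm (fun ω => sq_nonneg _) hsq hA'
    have h3 := R.integral_w (t + j) A hA'
    have h4 := R.setIntegral_le_two_mul (t + j) t A
    have h5 := ih t A hA
    have hbt : b (t + j) ≤ b t := hb (Nat.le_add_right t j)
    have hb0 : b t ≤ b 0 := hb (Nat.zero_le t)
    have hb1 : b (t + j) ^ 2 ≤ b t ^ 2 := pow_le_pow_left₀ (R.b_pos _).le hbt 2
    have hb2 : b t ^ 2 ≤ b 0 ^ 2 := pow_le_pow_left₀ (R.b_pos _).le hb0 2
    have ha1 : a (t + j) ^ 2 ≤ C ^ 2 * b t ^ 2 := by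
      rw [← mul_pow]
      exact pow_le_pow_left₀ (ha0 _) ((hab _).trans (mul_le_mul_of_nonneg_left hbt hC)) 2
    have h6 : ∫ ω in A, ‖e (t + j) ω‖ ^ 2 ∂μ ≤ (2 + 2 * c * b 0 ^ 2) * (V + μ.real A) := by
      have : c * b t ^ 2 * (V + μ.real A) ≤ c * b 0 ^ 2 * (V + μ.real A) := by gcongr
      linarith
    have h7 : b (t + j) ^ 2 * ∫ ω in A, ‖e (t + j) ω‖ ^ 2 * Y (t + j) ω ^ 2 ∂μ ≤
        b t ^ 2 * (ρ * ((2 + 2 * c * b 0 ^ 2) * (V + μ.real A))) := by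
      have := R.ρ_nonneg
      refine mul_le_mul hb1 (h2.trans (mul_le_mul_of_nonneg_left h6 this))
        (integral_nonneg fun ω => by positivity) (sq_nonneg _)
    have h8 : a (t + j) ^ 2 * ∫ ω in A, ‖w (t + j) ω‖ ^ 2 ∂μ ≤
        C ^ 2 * b t ^ 2 * (K * (V + μ.real A)) := by
      have := R.K_nonneg
      refine mul_le_mul ha1 (h3.trans (mul_le_mul_of_nonneg_left (by linarith) this))
        (integral_nonneg fun ω => by positivity) (by positivity)
    calc _ ≤ _ := h1
      _ ≤ 3 * (c * b t ^ 2 * (V + μ.real A))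
          + 3 * (b t ^ 2 * (ρ * ((2 + 2 * c * b 0 ^ 2) * (V + μ.real A))))
          + 3 * (C ^ 2 * b t ^ 2 * (K * (V + μ.real A))) := by gcongr
      _ = _ := by ring

theorem integrable_inner_apply (R : RandomLinearRecursion μ ℱ a b e D w Y ρ K) {t k : ℕ}
    (htk : t ≤ k) : Integrable (fun ω => inner ℝ (e t ω) (D k ω (e t ω))) μ := by
  have hY := R.integrable_mul_Y (R.measurable_norm_sq htk)
    (fun ω => sq_nonneg _) (R.integrable_sq t)
  refine Integrable.mono' (hY.const_mul (b k))
    ((R.stronglyMeasurable_e t).inner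
      (R.stronglyMeasurable_apply k (R.stronglyMeasurable_e t))).aestronglyMeasurable
    (ae_of_all _ fun ω => R.abs_inner_apply_le k ω (e t ω))

theorem abs_setIntegral_inner_apply_le (R : RandomLinearRecursion μ ℱ a b e D w Y ρ K) {t k : ℕ}
    (htk : t ≤ k) {A : Set Ω} (hA : MeasurableSet[ℱ t] A) :
    |∫ ω in A, inner ℝ (e t ω) (D k ω (e t ω)) ∂μ| ≤ b k * (ρ * ∫ ω in A, ‖e t ω‖ ^ 2 ∂μ) := by
  have hm := R.measurable_norm_sq htk
  have hY := R.integrable_mul_Y hm (fun ω => sq_nonneg _) (R.integrable_sq t)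
  refine (abs_integral_le_integral_abs).trans ?_
  refine le_trans ?_ (mul_le_mul_of_nonneg_left (R.setIntegral_mul_Y_le hm (fun ω => sq_nonneg _)
    (R.integrable_sq t) (ℱ.mono htk A hA)) (R.b_pos k).le)
  rw [← integral_const_mul]
  refine integral_mono (R.integrable_inner_apply htk).abs.integrableOn
    (hY.const_mul (b k)).integrableOn
    fun ω => R.abs_inner_apply_le k ω (e t ω)

theorem integrable_inner_w (R : RandomLinearRecursion μ ℱ a b e D w Y ρ K) (k : ℕ) :
    Integrable (fun ω => inner ℝ (e k ω - D k ω (e k ω)) (w k ω)) μ := by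
  have hm := R.measurable_norm_sq (le_refl k)
  have hY := R.integrable_mul_Y hm (fun ω => sq_nonneg _) (R.integrable_sq k)
  refine Integrable.mono' (((R.integrable_sq k).add (hY.const_mul (b k ^ 2))).add
    (R.integrable_w k))
    (((R.stronglyMeasurable_e k).sub (R.stronglyMeasurable_apply k
      (R.stronglyMeasurable_e k))).inner (R.measurable_w k)).aestronglyMeasurable
    (ae_of_all _ fun ω => ?_)
  have h1 := norm_sub_le (e k ω) (D k ω (e k ω))
  have h2 := R.norm_apply_sq_le k ω (e k ω)
  have h3 : ‖inner ℝ (e k ω - D k ω (e k ω)) (w k ω)‖ ≤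
      (‖e k ω‖ + ‖D k ω (e k ω)‖) * ‖w k ω‖ :=
    (norm_inner_le_norm _ _).trans (by gcongr)
  simp only [Pi.add_apply]
  nlinarith [sq_nonneg (‖e k ω‖ + ‖D k ω (e k ω)‖ - 2 * ‖w k ω‖),
    sq_nonneg (‖e k ω‖ - ‖D k ω (e k ω)‖)]

/-- The first-order term is frozen at `e t` because excitation will be available only given the past
of `t`. Orthogonality removes the noise cross term; the rest is `f * Y ^ 2` plus the noise energy,
of order `b t ^ 2`. -/
theorem setIntegral_step_le (R : RandomLinearRecursion μ ℱ a b e D w Y ρ K)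
    (hb : Antitone b) {C : ℝ} (hC : 0 ≤ C) (ha0 : ∀ k, 0 ≤ a k) (hab : ∀ k, a k ≤ C * b k) (j : ℕ) :
    ∃ c, 0 ≤ c ∧ ∀ t A, MeasurableSet[ℱ t] A → ∫ ω in A, ‖e (t + j + 1) ω‖ ^ 2 ∂μ ≤
      ∫ ω in A, ‖e (t + j) ω‖ ^ 2 ∂μ
        - 2 * ∫ ω in A, inner ℝ (e t ω) (D (t + j) ω (e t ω)) ∂μ
        + c * b t ^ 2 * (∫ ω in A, ‖e t ω‖ ^ 2 ∂μ + μ.real A) := by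
  obtain ⟨c, hc, hsub⟩ := R.setIntegral_sub_sq_le hb hC ha0 hab j
  refine ⟨ρ * (c + 3 * (2 + 2 * c * b 0 ^ 2) + 2) + C ^ 2 * K, ?_, fun t A hA => ?_⟩
  · have := R.ρ_nonneg
    have := R.K_nonneg
    positivity
  have hA' := ℱ.mono (Nat.le_add_right t j) A hA
  have hbt : b (t + j) ≤ b t := hb (Nat.le_add_right t j)
  have hb0 : b t ≤ b 0 := hb (Nat.zero_le t)
  have hb1 : b (t + j) ^ 2 ≤ b t ^ 2 := pow_le_pow_left₀ (R.b_pos _).le hbt 2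
  have hb2 : b t ^ 2 ≤ b 0 ^ 2 := pow_le_pow_left₀ (R.b_pos _).le hb0 2
  have ha1 : a (t + j) ^ 2 ≤ C ^ 2 * b t ^ 2 := by
    rw [← mul_pow]
    exact pow_le_pow_left₀ (ha0 _) ((hab _).trans (mul_le_mul_of_nonneg_left hbt hC)) 2
  let f : Ω → ℝ := fun ω => ‖e (t + j) ω - e t ω‖ ^ 2 + 3 * b (t + j) ^ 2 * ‖e (t + j) ω‖ ^ 2
    + 2 * b (t + j) ^ 2 * ‖e t ω‖ ^ 2
  have het := (R.measurable_e t).mono (ℱ.mono (Nat.le_add_right t j))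
  have hfm : StronglyMeasurable[ℱ (t + j)] f :=
    ((((R.measurable_e (t + j)).sub het).norm.pow 2).add
      (((R.measurable_e (t + j)).norm.pow 2).const_mul _)).add ((het.norm.pow 2).const_mul _)
  have hf0 : 0 ≤ f := fun ω => by simp only [f, Pi.zero_apply]; positivity
  have f1 := R.integrable_sub_sq (t + j) t
  have f2 := (R.integrable_sq (t + j)).const_mul (3 * b (t + j) ^ 2)
  have f3 := (R.integrable_sq t).const_mul (2 * b (t + j) ^ 2)
  have hfi : Integrable f μ := (f1.add f2).add f3
  have i1 := (R.integrable_sq (t + j)).integrableOn (s := A)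
  have i2 := ((R.integrable_inner_apply (Nat.le_add_right t j)).const_mul 2).integrableOn (s := A)
  have i3 := (R.integrable_mul_Y hfm hf0 hfi).integrableOn (s := A)
  have i4 := ((R.integrable_inner_w (t + j)).const_mul (2 * a (t + j))).integrableOn (s := A)
  have i5 := ((R.integrable_w (t + j)).const_mul (a (t + j) ^ 2)).integrableOn (s := A)
  have h1 : ∫ ω in A, ‖e (t + j + 1) ω‖ ^ 2 ∂μ ≤ ∫ ω in A, ‖e (t + j) ω‖ ^ 2 ∂μ
      - 2 * ∫ ω in A, inner ℝ (e t ω) (D (t + j) ω (e t ω)) ∂μ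
      + ∫ ω in A, f ω * Y (t + j) ω ^ 2 ∂μ
      + 2 * a (t + j) * ∫ ω in A, inner ℝ (e (t + j) ω - D (t + j) ω (e (t + j) ω)) (w (t + j) ω) ∂μ
      + a (t + j) ^ 2 * ∫ ω in A, ‖w (t + j) ω‖ ^ 2 ∂μ := by
    refine (integral_mono (R.integrable_sq _).integrableOn ((((i1.sub i2).add i3).add i4).add i5)
      fun ω => R.norm_step_sq_le (t + j) ω (e t ω)).trans_eq ?_
    simp only [← integral_const_mul]
    rw [integral_add' (((i1.sub i2).add i3).add i4) i5, integral_add' ((i1.sub i2).add i3) i4,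
      integral_add' (i1.sub i2) i3, integral_sub' i1 i2]
  rw [R.orthogonal (t + j) (R.integrable_sq _) A hA', mul_zero, add_zero] at h1
  have h2 := R.setIntegral_mul_Y_le hfm hf0 hfi hA'
  have h3 := R.integral_w (t + j) A hA'
  have h4 := R.setIntegral_le_two_mul (t + j) t A
  have h5 := hsub t A hA
  have hfA : ∫ ω in A, f ω ∂μ = ∫ ω in A, ‖e (t + j) ω - e t ω‖ ^ 2 ∂μ
      + 3 * b (t + j) ^ 2 * ∫ ω in A, ‖e (t + j) ω‖ ^ 2 ∂μ
      + 2 * b (t + j) ^ 2 * ∫ ω in A, ‖e t ω‖ ^ 2 ∂μ := by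
    refine (integral_add' (f1.add f2).integrableOn f3.integrableOn).trans ?_
    rw [integral_add' f1.integrableOn f2.integrableOn, integral_const_mul, integral_const_mul]
  set V := ∫ ω in A, ‖e t ω‖ ^ 2 ∂μ with hV
  have hV0 : 0 ≤ V := integral_nonneg fun ω => sq_nonneg _
  have hμ0 : 0 ≤ μ.real A := measureReal_nonneg
  have h6 : ∫ ω in A, ‖e (t + j) ω‖ ^ 2 ∂μ ≤ (2 + 2 * c * b 0 ^ 2) * (V + μ.real A) := by
    have : c * b t ^ 2 * (V + μ.real A) ≤ c * b 0 ^ 2 * (V + μ.real A) := by gcongr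
    linarith
  have h7 : ∫ ω in A, f ω ∂μ ≤ (c + 3 * (2 + 2 * c * b 0 ^ 2) + 2) * b t ^ 2 * (V + μ.real A) := by
    have h8 : 3 * b (t + j) ^ 2 * ∫ ω in A, ‖e (t + j) ω‖ ^ 2 ∂μ ≤
        3 * b t ^ 2 * ((2 + 2 * c * b 0 ^ 2) * (V + μ.real A)) :=
      mul_le_mul (by linarith) h6 (integral_nonneg fun ω => by positivity) (by positivity)
    have h9 : 2 * b (t + j) ^ 2 * V ≤ 2 * b t ^ 2 * (V + μ.real A) :=
      mul_le_mul (by linarith) (by linarith) hV0 (by positivity)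
    rw [hfA]
    linarith
  have h8 : a (t + j) ^ 2 * ∫ ω in A, ‖w (t + j) ω‖ ^ 2 ∂μ ≤
      C ^ 2 * b t ^ 2 * (K * (V + μ.real A)) := by
    have := R.K_nonneg
    refine mul_le_mul ha1 (h3.trans (mul_le_mul_of_nonneg_left (by linarith) this))
      (integral_nonneg fun ω => by positivity) (by positivity)
  have h9 := h2.trans (mul_le_mul_of_nonneg_left h7 R.ρ_nonneg)
  linarith

theorem setIntegral_block_le (R : RandomLinearRecursion μ ℱ a b e D w Y ρ K)
    (hb : Antitone b) {C : ℝ} (hC : 0 ≤ C) (ha0 : ∀ k, 0 ≤ a k) (hab : ∀ k, a k ≤ C * b k) (h : ℕ) :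
    ∃ c, 0 ≤ c ∧ ∀ t A, MeasurableSet[ℱ t] A → ∫ ω in A, ‖e (t + h) ω‖ ^ 2 ∂μ ≤
      ∫ ω in A, ‖e t ω‖ ^ 2 ∂μ
        - 2 * ∑ j ∈ Finset.range h, ∫ ω in A, inner ℝ (e t ω) (D (t + j) ω (e t ω)) ∂μ
        + c * b t ^ 2 * (∫ ω in A, ‖e t ω‖ ^ 2 ∂μ + μ.real A) := by
  induction h with
  | zero => exact ⟨0, le_rfl, fun t A _ => by simp⟩
  | succ h ih =>
    obtain ⟨c, hc, ih⟩ := ih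
    obtain ⟨c', hc', hstep⟩ := R.setIntegral_step_le hb hC ha0 hab h
    refine ⟨c + c', by positivity, fun t A hA => ?_⟩
    rw [Finset.sum_range_succ, ← add_assoc]
    linarith [ih t A hA, hstep t A hA]

end RandomLinearRecursion

/-! ### Gain sequences -/

namespace GainCondition

variable {a b : ℕ → ℝ}

theorem exists_a_le_mul_b (hG : GainCondition a b) : ∃ C, 0 < C ∧ ∀ k, a k ≤ C * b k := by
  obtain ⟨C, hC, h⟩ := bound_of_isBigO_nat_atTop hG.a_isBigO_b
  refine ⟨C, hC, fun k => ?_⟩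
  have := h (hG.b_pos k).ne'
  rwa [Real.norm_of_nonneg (hG.a_pos k).le, Real.norm_of_nonneg (hG.b_pos k).le] at this

/-- The form in which `b² = o(a)` is used when weights are compared inside a window. As `a` never
vanishes, the asymptotic bound holds at all times. -/
theorem exists_b_le_mul_sqrt (hG : GainCondition a b) : ∃ C, 0 < C ∧ ∀ k, b k ≤ C * √(a k) := by
  obtain ⟨C, hC, h⟩ := bound_of_isBigO_nat_atTop hG.b_sq_isLittleO.isBigO
  refine ⟨√C, Real.sqrt_pos.2 hC, fun k => ?_⟩
  have := h (hG.a_pos k).ne'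
  rw [Real.norm_of_nonneg (sq_nonneg _), Real.norm_of_nonneg (hG.a_pos k).le] at this
  rw [← Real.sqrt_mul hC.le]
  exact Real.le_sqrt_of_sq_le this

theorem exists_a_le_mul_shift (hG : GainCondition a b) {h : ℕ} (hh : 0 < h) :
    ∃ C, 0 < C ∧ ∀ k, a k ≤ C * a (k + h) := by
  obtain ⟨C, hC, hb⟩ := bound_of_isBigO_nat_atTop (hG.a_isBigO_shift h hh)
  refine ⟨C, hC, fun k => ?_⟩
  have := hb (hG.a_pos (k + h)).ne'
  rwa [Real.norm_of_nonneg (hG.a_pos k).le, Real.norm_of_nonneg (hG.a_pos _).le] at this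

/-- The change of the innovation gain within a window, weighted by the consensus gain, is
controlled by a telescoping quantity. -/
theorem exists_ratio_sub_one_mul_le (hG : GainCondition a b) {h : ℕ} (hh : 0 < h) :
    ∃ C, 0 ≤ C ∧ ∀ t, ∀ j ≤ h, (a t / a (t + j) - 1) * b (t + j) ≤ C * (√(a t) - √(a (t + h))) := by
  obtain ⟨B, hB, hb⟩ := hG.exists_b_le_mul_sqrt
  obtain ⟨C, hC, ha⟩ := hG.exists_a_le_mul_shift hh
  refine ⟨B * (√C + 1), by positivity, fun t j hj => ?_⟩
  have hpos := hG.a_pos (t + j)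
  set s := √(a (t + j)) with hs
  have hs0 : 0 < s := Real.sqrt_pos.2 hpos
  have h1 : √(a t) ≤ √C * s := by
    rw [hs, ← Real.sqrt_mul hC.le]
    exact Real.sqrt_le_sqrt ((ha t).trans
      (mul_le_mul_of_nonneg_left (hG.a_anti (by lia)) hC.le))
  have h2 : √(a (t + h)) ≤ s := Real.sqrt_le_sqrt (hG.a_anti (by lia))
  have h3 : s ≤ √(a t) := Real.sqrt_le_sqrt (hG.a_anti (by lia))
  -- Difference of squares. The sum `√(a t) + s` is at most a multiple of `s` and `b (t + j) ≤ B *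
  -- s`, so the denominator `s ^ 2` cancels and one difference of square roots remains.
  have h4 : a t / a (t + j) - 1 = (√(a t) - s) * (√(a t) + s) / s ^ 2 := by
    have e1 : s ^ 2 = a (t + j) := Real.sq_sqrt hpos.le
    have e2 : √(a t) ^ 2 = a t := Real.sq_sqrt (hG.a_pos t).le
    rw [e1, div_sub_one hpos.ne']
    congr 1
    linear_combination e1 - e2
  rw [h4]
  calc (√(a t) - s) * (√(a t) + s) / s ^ 2 * b (t + j)
      ≤ (√(a t) - s) * (√C * s + s) / s ^ 2 * (B * s) := by
        have := (hG.b_pos (t + j)).le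
        have : 0 ≤ √(a t) - s := by linarith
        gcongr
        exact hb _
    _ = B * (√C + 1) * (√(a t) - s) := by field_simp
    _ ≤ _ := by gcongr

theorem summable_sqrt_sub (hG : GainCondition a b) (h : ℕ) :
    Summable fun m => √(a (m * h)) - √(a ((m + 1) * h)) := by
  refine summable_of_sum_range_le (c := √(a 0)) (fun m => sub_nonneg.2
    (Real.sqrt_le_sqrt (hG.a_anti (by gcongr; lia)))) fun m => ?_
  have := Finset.sum_range_sub' (fun m => √(a (m * h))) m
  rw [this]
  simp [Real.sqrt_nonneg]

/-- As `a` decreases, the sum over one window is at most `h` times its first term. -/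
theorem tendsto_sum_window (hG : GainCondition a b) {h : ℕ} (hh : 0 < h) :
    Tendsto (fun K => ∑ m ∈ Finset.range K, a (m * h)) atTop atTop := by
  have h1 : ∀ K, ∑ k ∈ Finset.range (K * h), a k ≤ h * ∑ m ∈ Finset.range K, a (m * h) := by
    intro K
    induction K with
    | zero => simp
    | succ K ih =>
      rw [Finset.sum_range_succ, mul_add, add_mul, one_mul, Finset.sum_range_add]
      have : ∑ x ∈ Finset.range h, a (K * h + x) ≤ ∑ _x ∈ Finset.range h, a (K * h) :=
        Finset.sum_le_sum fun x _ => hG.a_anti (Nat.le_add_right _ _)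
      rw [Finset.sum_const, Finset.card_range, nsmul_eq_mul] at this
      linarith
  have h2 : Tendsto (fun K => ∑ k ∈ Finset.range (K * h), a k) atTop atTop :=
    hG.a_sum.comp (tendsto_id.atTop_mul_const' hh)
  have h3 := tendsto_atTop_mono h1 h2
  have hh' : (0 : ℝ) < h := by exact_mod_cast hh
  exact (tendsto_const_mul_atTop_of_pos hh').1 h3

end GainCondition

/-! ### Almost sure convergence of the recursion -/

theorem tendsto_of_tendsto_window {E : Type*} [TopologicalSpace E] {f : ℕ → E} {x : E} {h : ℕ}
    (hh : 0 < h) (hf : ∀ j < h, Tendsto (fun m => f (m * h + j)) atTop (𝓝 x)) :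
    Tendsto f atTop (𝓝 x) := by
  refine tendsto_iff_forall_eventually_mem.2 fun U hU => ?_
  -- Finitely many residues modulo `h`, so a single threshold serves all of them.
  have h1 : ∀ᶠ m in atTop, ∀ j ∈ Finset.range h, f (m * h + j) ∈ U :=
    (Finset.eventually_all _).2 fun j hj => hf j (Finset.mem_range.1 hj) hU
  have h2 := (Nat.tendsto_div_const_atTop hh.ne').eventually h1
  filter_upwards [h2] with k hk
  have := hk (k % h) (Finset.mem_range.2 (Nat.mod_lt k hh))
  rwa [Nat.div_add_mod'] at this

/-- The squared norm at the window starts is an almost supermartingale: excitation supplies the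
decrease `2 * θ * a (m * h)`, and all other contributions have summable coefficients. -/
theorem RandomLinearRecursion.ae_tendsto_zero {Ω E : Type*} {mΩ : MeasurableSpace Ω}
    [NormedAddCommGroup E] [InnerProductSpace ℝ E] {μ : Measure Ω} [IsProbabilityMeasure μ]
    {ℱ : Filtration ℕ mΩ} {a b : ℕ → ℝ} {e : ℕ → Ω → E} {D : ℕ → Ω → E →L[ℝ] E} {w : ℕ → Ω → E}
    {Y : ℕ → Ω → ℝ} {ρ K : ℝ} (R : RandomLinearRecursion μ ℱ a b e D w Y ρ K)
    (hG : GainCondition a b) (hb : Summable fun k => b k ^ 2) {h : ℕ} (hh : 0 < h) {θ : ℝ}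
    (hθ : 0 < θ)
    (hexc : ∀ m A, MeasurableSet[ℱ (m * h)] A → θ * ∫ ω in A, ‖e (m * h) ω‖ ^ 2 ∂μ ≤
      ∑ j ∈ Finset.range h, (a (m * h + j))⁻¹ *
        ∫ ω in A, inner ℝ (e (m * h) ω) (D (m * h + j) ω (e (m * h) ω)) ∂μ) :
    ∀ᵐ ω ∂μ, Tendsto (fun k => e k ω) atTop (𝓝 0) := by
  obtain ⟨C, hC, hab⟩ := hG.exists_a_le_mul_b
  have ha0 : ∀ k, 0 ≤ a k := fun k => (hG.a_pos k).le
  obtain ⟨c, hc, hblock⟩ := R.setIntegral_block_le hG.b_anti hC.le ha0 hab h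
  obtain ⟨B, hB, hratio⟩ := hG.exists_ratio_sub_one_mul_le hh
  have hρ := R.ρ_nonneg
  have hbs : Summable fun m => b (m * h) ^ 2 :=
    hb.comp_injective fun i j hij => Nat.eq_of_mul_eq_mul_right hh hij
  let 𝒢 : Filtration ℕ mΩ :=
    { seq := fun m => ℱ (m * h)
      mono' := fun i j hij => ℱ.mono (Nat.mul_le_mul_right h hij)
      le' := fun m => ℱ.le _ }
  have hd : ∀ m, 0 ≤ √(a (m * h)) - √(a ((m + 1) * h)) := fun m =>
    sub_nonneg.2 (Real.sqrt_le_sqrt (hG.a_anti (by gcongr; lia)))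
  -- In `γ`, the first summand pays for replacing the weights `1 / a (m * h + j)` by `1 / a (m * h)`
  -- in `h` terms, the second is the remainder of the window estimate. The same `γ` also serves as
  -- additive error, where its first summand is mere slack.
  obtain ⟨hlim, M, hM⟩ := ae_tendsto_zero_of_almost_supermartingale (μ := μ) 𝒢
    (V := fun m ω => ‖e (m * h) ω‖ ^ 2)
    (γ := fun m => 2 * (h * (B * ρ * (√(a (m * h)) - √(a ((m + 1) * h))))) + c * b (m * h) ^ 2)
    (α := fun m => 2 * θ * a (m * h))
    (fun m => R.measurable_norm_sq le_rfl) (fun m => R.integrable_sq _) (fun m ω => sq_nonneg _)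
    (fun m => by have := hd m; positivity)
    ((((hG.summable_sqrt_sub h).mul_left (B * ρ)).mul_left (h : ℝ)).mul_left 2 |>.add
      (hbs.mul_left c))
    (fun m => by have := ha0 (m * h); positivity)
    (by
      simp_rw [← Finset.mul_sum]
      exact (hG.tendsto_sum_window hh).const_mul_atTop (by positivity))
    (by
      intro m A hA
      replace hA : MeasurableSet[ℱ (m * h)] A := hA
      have h1 := hblock (m * h) A hA
      have h2 := hexc m A hA
      have hmh : (m + 1) * h = m * h + h := by ring
      have h3 := hd m
      have h4 := hratio (m * h)
      rw [hmh] at h3 ⊢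
      generalize m * h = t at *
      set V := ∫ ω in A, ‖e t ω‖ ^ 2 ∂μ
      have hV : 0 ≤ V := integral_nonneg fun ω => sq_nonneg _
      have hμA : 0 ≤ μ.real A := measureReal_nonneg
      -- The integrals have no sign, so the weight change is charged to their absolute value, at
      -- most `b * ρ * V`, and then to the telescoping bound.
      have h5 : ∀ j ∈ Finset.range h,
          a t * ((a (t + j))⁻¹ * ∫ ω in A, inner ℝ (e t ω) (D (t + j) ω (e t ω)) ∂μ)
          - B * ρ * (√(a t) - √(a (t + h))) * V
          ≤ ∫ ω in A, inner ℝ (e t ω) (D (t + j) ω (e t ω)) ∂μ := by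
        intro j hj
        have hj' := (Finset.mem_range.1 hj).le
        have h6 := R.abs_setIntegral_inner_apply_le (Nat.le_add_right t j) hA
        set I := ∫ ω in A, inner ℝ (e t ω) (D (t + j) ω (e t ω)) ∂μ
        have h7 : 0 ≤ a t / a (t + j) - 1 := by
          rw [sub_nonneg, one_le_div (hG.a_pos _)]
          exact hG.a_anti (Nat.le_add_right t j)
        have h8 : (a t / a (t + j) - 1) * I ≤ B * ρ * (√(a t) - √(a (t + h))) * V :=
          calc (a t / a (t + j) - 1) * I ≤ (a t / a (t + j) - 1) * (b (t + j) * (ρ * V)) := by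
                gcongr
                exact (le_abs_self I).trans h6
            _ = ((a t / a (t + j) - 1) * b (t + j)) * (ρ * V) := by ring
            _ ≤ (B * (√(a t) - √(a (t + h)))) * (ρ * V) := by
                exact mul_le_mul_of_nonneg_right (h4 j hj') (mul_nonneg hρ hV)
            _ = _ := by ring
        rw [← mul_assoc, ← div_eq_mul_inv]
        linarith
      have h6 := Finset.sum_le_sum h5
      rw [Finset.sum_sub_distrib, ← Finset.mul_sum, Finset.sum_const, Finset.card_range,
        nsmul_eq_mul] at h6
      have h7 := mul_le_mul_of_nonneg_left h2 (ha0 t)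
      have h8 : 0 ≤ 2 * (h * (B * ρ * (√(a t) - √(a (t + h))))) * μ.real A := by positivity
      linarith)
  -- The mean squares of the increments are at most `c' * b (m * h) ^ 2 * (M + 1)`, where `M` is the
  -- uniform second-moment bound from the supermartingale argument.
  have hincr : ∀ j, ∀ᵐ ω ∂μ, Tendsto (fun m => ‖e (m * h + j) ω - e (m * h) ω‖ ^ 2) atTop (𝓝 0) := by
    intro j
    obtain ⟨c', hc', hsub⟩ := R.setIntegral_sub_sq_le hG.b_anti hC.le ha0 hab j
    refine ae_tendsto_zero_of_summable_integral (fun m ω => sq_nonneg _)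
      (fun m => R.integrable_sub_sq _ _) (g := fun m => c' * b (m * h) ^ 2 * (M + 1))
      (fun m => ?_) ((hbs.mul_left c').mul_right _)
    have h1 := hsub (m * h) Set.univ MeasurableSet.univ
    simp only [setIntegral_univ, probReal_univ] at h1
    exact h1.trans (by gcongr; exact hM m)
  filter_upwards [hlim, ae_all_iff.2 hincr] with ω h1 h2
  have hroot : ∀ {f : ℕ → E}, Tendsto (fun m => ‖f m‖ ^ 2) atTop (𝓝 0) →
      Tendsto f atTop (𝓝 0) := fun {f} hf => by
    rw [tendsto_zero_iff_norm_tendsto_zero]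
    simpa using hf.sqrt
  refine tendsto_of_tendsto_window hh fun j _ => ?_
  simpa using (hroot (h2 j)).add (hroot h1)

/-! ### Random matrices and quadratic forms -/

theorem stronglyMeasurable_matrix {Ω ι κ : Type*} [Fintype ι] [Fintype κ] [DecidableEq κ]
    {𝒢 : MeasurableSpace Ω} {M : Ω → Matrix ι κ ℝ} (hM : ∀ p q, Measurable fun ω => M ω p q) :
    StronglyMeasurable M := by
  let f : Ω → ι → κ → ℝ := fun ω p q => M ω p q
  have hf : Measurable f := measurable_pi_iff.2 fun p => measurable_pi_iff.2 fun q => hM p q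
  exact hf.stronglyMeasurable

theorem stronglyMeasurable_toLp {Ω ι : Type*} [Fintype ι] {𝒢 : MeasurableSpace Ω}
    {f : Ω → ι → ℝ} (hf : ∀ i, Measurable fun ω => f ω i) :
    StronglyMeasurable fun ω => (WithLp.toLp 2 (f ω) : EuclideanSpace ℝ ι) :=
  (PiLp.continuous_toLp 2 _).comp_stronglyMeasurable (measurable_pi_iff.2 hf).stronglyMeasurable

theorem stronglyMeasurable_toEuclideanCLM {Ω ι : Type*} [Fintype ι] [DecidableEq ι]
    {𝒢 : MeasurableSpace Ω} {M : Ω → Matrix ι ι ℝ} (hM : ∀ p q, Measurable fun ω => M ω p q) :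
    StronglyMeasurable fun ω => Matrix.toEuclideanCLM (n := ι) (𝕜 := ℝ) (M ω) :=
  (LinearMap.continuous_of_finiteDimensional
    (Matrix.toEuclideanCLM (n := ι) (𝕜 := ℝ)).toAlgEquiv.toLinearMap).comp_stronglyMeasurable
      (stronglyMeasurable_matrix hM)

theorem stronglyMeasurable_toEuclideanCLM_apply {Ω ι : Type*} [Fintype ι] [DecidableEq ι]
    {𝒢 : MeasurableSpace Ω} {M : Ω → Matrix ι ι ℝ} (hM : ∀ p q, Measurable fun ω => M ω p q)
    {f : Ω → EuclideanSpace ℝ ι} (hf : StronglyMeasurable f) :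
    StronglyMeasurable fun ω => Matrix.toEuclideanCLM (𝕜 := ℝ) (M ω) (f ω) :=
  isBoundedBilinearMap_apply.continuous.comp_stronglyMeasurable
    ((stronglyMeasurable_toEuclideanCLM hM).prodMk hf)

/-- The spectrum is finite, so its infimum bounds every eigenvalue from below and `M - θ` is
positive semidefinite. For an empty index type the default `sInf ∅ = 0` does no harm, as both sides
vanish. -/
theorem mul_norm_sq_le_of_le_lambdaMin {ι : Type*} [Fintype ι] [DecidableEq ι] {M : Matrix ι ι ℝ}
    (hM : M.IsHermitian) {θ : ℝ} (h : θ ≤ lambdaMin M) (x : EuclideanSpace ℝ ι) :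
    θ * ‖x‖ ^ 2 ≤ x.ofLp ⬝ᵥ M *ᵥ x.ofLp := by
  have hP : (M - algebraMap ℝ (Matrix ι ι ℝ) θ).PosSemidef := by
    rw [Matrix.posSemidef_iff_isHermitian_and_spectrum_nonneg]
    refine ⟨hM.sub ?_, ?_⟩
    · rw [Matrix.algebraMap_eq_diagonal]
      exact Matrix.isHermitian_diagonal _
    · rw [← spectrum.sub_singleton_eq]
      rintro _ ⟨y, hy, z, rfl, rfl⟩
      exact sub_nonneg.2 (h.trans (csInf_le M.finite_real_spectrum.bddBelow hy))
  have h1 := hP.dotProduct_mulVec_nonneg x.ofLp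
  have h2 : x.ofLp ⬝ᵥ x.ofLp = ‖x‖ ^ 2 := by
    rw [EuclideanSpace.real_norm_sq_eq]
    simp [dotProduct, sq]
  rw [Matrix.sub_mulVec, dotProduct_sub, Algebra.algebraMap_eq_smul_one, Matrix.smul_mulVec,
    Matrix.one_mulVec, dotProduct_smul, star_trivial, h2, smul_eq_mul] at h1
  linarith

theorem abs_entry_le_l2_opNorm {ι κ : Type*} [Fintype ι] [Fintype κ] [DecidableEq κ]
    (M : Matrix ι κ ℝ) (p : ι) (q : κ) : |M p q| ≤ ‖M‖ := by
  have h := Matrix.l2_opNorm_mulVec M (EuclideanSpace.single q (1 : ℝ))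
  rw [PiLp.norm_single, norm_one, mul_one] at h
  refine le_trans ?_ h
  have h1 := PiLp.norm_apply_le ((EuclideanSpace.equiv ι ℝ).symm
    (M *ᵥ (EuclideanSpace.single q (1 : ℝ)).ofLp)) p
  simpa using h1

/-- `L ⊗ 1` applies `L` separately to each slice `x (·, c)`, and the squared norms of the slices add
up. -/
theorem l2_opNorm_kronecker_one_le {ι κ : Type*} [Fintype ι] [Fintype κ] [DecidableEq ι]
    [DecidableEq κ] (L : Matrix ι ι ℝ) : ‖L ⊗ₖ (1 : Matrix κ κ ℝ)‖ ≤ ‖L‖ := by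
  rw [← Matrix.l2_opNorm_toEuclideanCLM]
  refine ContinuousLinearMap.opNorm_le_bound _ (norm_nonneg _) fun x => ?_
  refine (sq_le_sq₀ (norm_nonneg _) (by positivity)).1 ?_
  let y : κ → EuclideanSpace ℝ ι := fun c => WithLp.toLp 2 fun i => x (i, c)
  have h1 : ∀ i c, Matrix.toEuclideanCLM (𝕜 := ℝ) (L ⊗ₖ (1 : Matrix κ κ ℝ)) x (i, c)
      = (L *ᵥ (y c).ofLp) i := by
    intro i c
    simp [Matrix.mulVec, dotProduct, Fintype.sum_prod_type, Matrix.one_apply, y]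
  have h2 : ∀ c, ∑ i, (L *ᵥ (y c).ofLp) i ^ 2 ≤ ‖L‖ ^ 2 * ‖y c‖ ^ 2 := by
    intro c
    have h := Matrix.l2_opNorm_mulVec L (y c)
    have h' := pow_le_pow_left₀ (norm_nonneg _) h 2
    rw [EuclideanSpace.real_norm_sq_eq, mul_pow] at h'
    simpa using h'
  have h3 : ‖x‖ ^ 2 = ∑ c, ‖y c‖ ^ 2 := by
    simp_rw [EuclideanSpace.real_norm_sq_eq, y]
    rw [Fintype.sum_prod_type, Finset.sum_comm]
  rw [EuclideanSpace.real_norm_sq_eq, mul_pow, h3, Finset.mul_sum, Fintype.sum_prod_type,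
    Finset.sum_comm]
  refine Finset.sum_le_sum fun c _ => ?_
  simp_rw [h1]
  exact h2 c

/-- Valid at every `ω`, with no null set: the entries `(p, q)` and `(q, p)` are conditional
expectations of one and the same function. -/
theorem condExpMatrix_isHermitian {Ω : Type*} {mΩ : MeasurableSpace Ω} (μ : Measure Ω) {ι : Type*}
    (𝒢 : MeasurableSpace Ω) {M : Ω → Matrix ι ι ℝ} (hM : ∀ ω, (M ω).IsHermitian) (ω : Ω) :
    (condExpMatrix μ 𝒢 M ω).IsHermitian := by
  ext p q
  have : (fun ω' => M ω' q p) = fun ω' => M ω' p q := by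
    ext ω'
    simpa using (hM ω').apply p q
  simp [condExpMatrix, this]

/-- A quadratic form with conditioned-on argument may be evaluated at the conditional
expectation of the matrix. -/
theorem integrable_and_setIntegral_condExpMatrix {Ω : Type*} {𝒢 mΩ : MeasurableSpace Ω}
    {μ : Measure Ω} [IsFiniteMeasure μ] (h𝒢 : 𝒢 ≤ mΩ) {ι : Type*} [Fintype ι]
    {M : Ω → Matrix ι ι ℝ} {N : Ω → Matrix ι ι ℝ} {x : Ω → ι → ℝ}
    (hx : ∀ p, StronglyMeasurable[𝒢] fun ω => x ω p)
    (hM : ∀ p q, Integrable (fun ω => M ω p q) μ)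
    (hxM : ∀ p q, Integrable (fun ω => x ω p * x ω q * M ω p q) μ)
    (hN : ∀ p q, ∀ᵐ ω ∂μ, condExpMatrix μ 𝒢 M ω p q = N ω p q) {A : Set Ω}
    (hA : MeasurableSet[𝒢] A) :
    IntegrableOn (fun ω => x ω ⬝ᵥ N ω *ᵥ x ω) A μ ∧
      ∫ ω in A, x ω ⬝ᵥ M ω *ᵥ x ω ∂μ = ∫ ω in A, x ω ⬝ᵥ N ω *ᵥ x ω ∂μ := by
  have hform : ∀ (P : Ω → Matrix ι ι ℝ) ω,
      x ω ⬝ᵥ P ω *ᵥ x ω = ∑ p, ∑ q, x ω p * x ω q * P ω p q := by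
    intro P ω
    simp only [dotProduct, Matrix.mulVec, Finset.mul_sum]
    exact Finset.sum_congr rfl fun p _ => Finset.sum_congr rfl fun q _ => by ring
  have hpull : ∀ p q, μ[fun ω => x ω p * x ω q * M ω p q | 𝒢]
      =ᵐ[μ] fun ω => x ω p * x ω q * N ω p q := by
    intro p q
    refine (condExp_mul_of_stronglyMeasurable_left ((hx p).mul (hx q)) (hxM p q) (hM p q)).trans ?_
    filter_upwards [hN p q] with ω hω
    rw [Pi.mul_apply, Pi.mul_apply, ← hω]
    rfl
  have hNi : ∀ p q, Integrable (fun ω => x ω p * x ω q * N ω p q) μ := fun p q =>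
    integrable_condExp.congr (hpull p q)
  simp_rw [hform]
  refine ⟨(integrable_finsetSum _ fun p _ => integrable_finsetSum _ fun q _ =>
    hNi p q).integrableOn, ?_⟩
  rw [integral_finsetSum _ fun p _ => integrable_finsetSum _ fun q _ => (hxM p q).integrableOn,
    integral_finsetSum _ fun p _ => integrable_finsetSum _ fun q _ => (hNi p q).integrableOn]
  refine Finset.sum_congr rfl fun p _ => ?_
  rw [integral_finsetSum _ fun q _ => (hxM p q).integrableOn,
    integral_finsetSum _ fun q _ => (hNi p q).integrableOn]
  refine Finset.sum_congr rfl fun q _ => ?_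
  rw [← setIntegral_condExp h𝒢 (hxM p q) hA]
  exact integral_congr_ae (ae_restrict_of_ae (hpull p q))

/-! ### The network: σ-algebras and measurability -/

namespace SensorNetwork

variable {Ω : Type*} [mΩ : MeasurableSpace Ω] {N n d : ℕ} {m : Fin N → ℕ}

theorem noiseSigma_le (S : SensorNetwork Ω N n d m) (k : ℕ) : S.noiseSigma k ≤ mΩ :=
  iSup_le fun i => (S.measurable_v k i).comap_le

theorem modelSigma_le (S : SensorNetwork Ω N n d m) (k : ℕ) : S.modelSigma k ≤ mΩ :=
  sup_le (sup_le
    (iSup_le fun i => iSup_le fun p => iSup_le fun c => (S.measurable_H k i p c).comap_le)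
    (iSup_le fun i => iSup_le fun j => (S.measurable_adj k i j).comap_le))
    (iSup_le fun j => iSup_le fun i => (S.measurable_delay k j i).comap_le)

/-- The filtration of the pasts `𝓕(k - 1)`. -/
def pastFiltration (S : SensorNetwork Ω N n d m) : Filtration ℕ mΩ where
  seq := S.past
  mono' _ _ hij := iSup_mono fun _ => iSup_mono' fun hs => ⟨hs.trans_le hij, le_rfl⟩
  le' _ := iSup_le fun s => iSup_le fun _ => sup_le (S.noiseSigma_le s) (S.modelSigma_le s)

theorem past_le (S : SensorNetwork Ω N n d m) (k : ℕ) : S.past k ≤ mΩ :=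
  S.pastFiltration.le k

theorem noiseSigma_sup_modelSigma_le_past (S : SensorNetwork Ω N n d m) (k : ℕ) :
    S.noiseSigma k ⊔ S.modelSigma k ≤ S.past (k + 1) :=
  le_iSup₂_of_le k k.lt_succ_self le_rfl

/-- The σ-algebra generated by the noises at the times `s < k`. -/
abbrev noisePast (S : SensorNetwork Ω N n d m) (k : ℕ) : MeasurableSpace Ω :=
  ⨆ s, ⨆ _ : s < k, S.noiseSigma s

/-- The σ-algebra generated by the whole model and by the noises at the times `s < k`. -/
abbrev modelNoisePast (S : SensorNetwork Ω N n d m) (k : ℕ) : MeasurableSpace Ω :=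
  (⨆ s, S.modelSigma s) ⊔ S.noisePast k

theorem noisePast_le_past (S : SensorNetwork Ω N n d m) (k : ℕ) : S.noisePast k ≤ S.past k :=
  iSup_mono fun _ => iSup_mono fun _ => le_sup_left

theorem past_le_modelNoisePast (S : SensorNetwork Ω N n d m) (k : ℕ) :
    S.past k ≤ S.modelNoisePast k :=
  iSup_le fun s => iSup_le fun hs => sup_le
    ((le_iSup₂_of_le (f := fun s (_ : s < k) => S.noiseSigma s) s hs le_rfl).trans le_sup_right)
    ((le_iSup S.modelSigma s).trans le_sup_left)

theorem modelSigma_le_modelNoisePast (S : SensorNetwork Ω N n d m) (k : ℕ) :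
    S.modelSigma k ≤ S.modelNoisePast k :=
  (le_iSup S.modelSigma k).trans le_sup_left

theorem modelNoisePast_le (S : SensorNetwork Ω N n d m) (k : ℕ) : S.modelNoisePast k ≤ mΩ :=
  sup_le (iSup_le S.modelSigma_le) (iSup_le fun s => iSup_le fun _ => S.noiseSigma_le s)

theorem measurable_H_modelSigma (S : SensorNetwork Ω N n d m) (k : ℕ) (i : Fin N) (p : Fin (m i))
    (c : Fin n) : Measurable[S.modelSigma k] fun ω => S.H k i ω p c := by
  rw [measurable_iff_comap_le]
  have h1 := le_iSup (fun c => MeasurableSpace.comap (fun ω => S.H k i ω p c) inferInstance) c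
  have h2 := le_iSup (fun p => ⨆ c,
    MeasurableSpace.comap (fun ω => S.H k i ω p c) inferInstance) p
  have h3 := le_iSup (fun i => ⨆ p, ⨆ c,
    MeasurableSpace.comap (fun ω => S.H k i ω p c) inferInstance) i
  exact ((h1.trans h2).trans h3).trans (le_sup_left.trans le_sup_left)

theorem measurable_adj_modelSigma (S : SensorNetwork Ω N n d m) (k : ℕ) (i j : Fin N) :
    Measurable[S.modelSigma k] fun ω => S.adj k ω i j := by
  rw [measurable_iff_comap_le]
  have h1 := le_iSup (fun j => MeasurableSpace.comap (fun ω => S.adj k ω i j) inferInstance) j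
  have h2 := le_iSup (fun i => ⨆ j,
    MeasurableSpace.comap (fun ω => S.adj k ω i j) inferInstance) i
  exact (h1.trans h2).trans (le_sup_right.trans le_sup_left)

theorem measurable_blockH (S : SensorNetwork Ω N n d m) (k : ℕ) (p q) :
    Measurable[S.modelSigma k] fun ω => S.blockH k ω p q := by
  by_cases h : p.1 = q.1
  · simpa [blockH, h] using S.measurable_H_modelSigma k p.1 p.2 q.2
  · simp [blockH, h]

theorem measurable_gram (S : SensorNetwork Ω N n d m) (k : ℕ) (p q) :
    Measurable[S.modelSigma k] fun ω => S.gram k ω p q := by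
  simp only [gram, Matrix.mul_apply, Matrix.transpose_apply]
  exact Finset.measurable_sum _ fun r _ =>
    (S.measurable_blockH k r p).mul (S.measurable_blockH k r q)

theorem measurable_laplacian (S : SensorNetwork Ω N n d m) (k : ℕ) (i j) :
    Measurable[S.modelSigma k] fun ω => S.laplacian k ω i j := by
  simp only [laplacian, Matrix.sub_apply, Matrix.diagonal_apply]
  refine Measurable.sub ?_ (S.measurable_adj_modelSigma k i j)
  by_cases h : i = j
  · simpa [h] using Finset.measurable_sum _ fun l _ => S.measurable_adj_modelSigma k j l
  · simp [h]

theorem measurable_noise (S : SensorNetwork Ω N n d m) (k : ℕ) (p) :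
    Measurable[S.noiseSigma k] fun ω => S.noise k ω p := by
  have h1 : Measurable[S.noiseSigma k] (S.v k p.1) := by
    rw [measurable_iff_comap_le]
    exact le_iSup (fun i => MeasurableSpace.comap (S.v k i) inferInstance) p.1
  exact (measurable_pi_apply p.2).comp h1

theorem stronglyMeasurable_noise (S : SensorNetwork Ω N n d m) (k : ℕ) :
    StronglyMeasurable[S.noiseSigma k] (S.noise k) :=
  stronglyMeasurable_toLp (S.measurable_noise k)

theorem norm_gram (S : SensorNetwork Ω N n d m) (k : ℕ) (ω : Ω) :
    ‖S.gram k ω‖ = ‖S.blockH k ω‖ ^ 2 := by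
  rw [sq, ← Matrix.l2_opNorm_conjTranspose_mul_self, Matrix.conjTranspose_eq_transpose_of_trivial,
    gram]

/-! ### Error dynamics -/

/-- The matrix of the mean error dynamics, `b(k) L(k) ⊗ I + a(k) 𝓗(k)ᵀ 𝓗(k)`. -/
def drift (S : SensorNetwork Ω N n d m) (a b : ℕ → ℝ) (k : ℕ) (ω : Ω) :
    Matrix (Fin N × Fin n) (Fin N × Fin n) ℝ :=
  b k • (S.laplacian k ω ⊗ₖ (1 : Matrix (Fin n) (Fin n) ℝ)) + a k • S.gram k ω

/-- The noise `𝓗(k)ᵀ v(k)` entering the error dynamics. -/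
def innovationNoise (S : SensorNetwork Ω N n d m) (k : ℕ) (ω : Ω) :
    EuclideanSpace ℝ (Fin N × Fin n) :=
  WithLp.toLp 2 ((S.blockH k ω)ᵀ *ᵥ (S.noise k ω).ofLp)

/-- The estimation errors of the delay-free algorithm. -/
def estError (S : SensorNetwork Ω N n d m) (x₀ : Fin n → ℝ) (a b : ℕ → ℝ)
    (ξ : Fin N → Fin n → ℝ) : ℕ → Ω → EuclideanSpace ℝ (Fin N × Fin n)
  | 0 => fun _ => WithLp.toLp 2 fun p => ξ p.1 p.2 - x₀ p.2
  | k + 1 => fun ω => S.estError x₀ a b ξ k ω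
      - Matrix.toEuclideanCLM (𝕜 := ℝ) (S.drift a b k ω) (S.estError x₀ a b ξ k ω)
      + a k • S.innovationNoise k ω

theorem measurable_drift (S : SensorNetwork Ω N n d m) (a b : ℕ → ℝ) (k : ℕ) (p q) :
    Measurable[S.modelSigma k] fun ω => S.drift a b k ω p q := by
  simp only [drift, Matrix.add_apply, Matrix.smul_apply, Matrix.kroneckerMap_apply]
  exact (((S.measurable_laplacian k p.1 q.1).mul_const _).const_smul (b k)).add
    ((S.measurable_gram k p q).const_smul (a k))

theorem stronglyMeasurable_innovationNoise (S : SensorNetwork Ω N n d m) (k : ℕ) :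
    StronglyMeasurable[S.noiseSigma k ⊔ S.modelSigma k] (S.innovationNoise k) := by
  refine stronglyMeasurable_toLp fun p => ?_
  simp only [Matrix.mulVec, dotProduct, Matrix.transpose_apply]
  exact Finset.measurable_sum _ fun q _ =>
    ((S.measurable_blockH k q p).mono le_sup_right le_rfl).mul
      ((S.measurable_noise k q).mono le_sup_left le_rfl)

theorem stronglyMeasurable_estError (S : SensorNetwork Ω N n d m) (x₀ : Fin n → ℝ) (a b : ℕ → ℝ)
    (ξ : Fin N → Fin n → ℝ) (k : ℕ) :
    StronglyMeasurable[S.past k] (S.estError x₀ a b ξ k) := by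
  induction k with
  | zero => exact stronglyMeasurable_const
  | succ k ih =>
    have h1 := S.noiseSigma_sup_modelSigma_le_past k
    have h2 := ih.mono (S.pastFiltration.mono k.le_succ)
    exact (h2.sub (stronglyMeasurable_toEuclideanCLM_apply
      (fun p q => (S.measurable_drift a b k p q).mono (le_sup_right.trans h1) le_rfl) h2)).add
      (((S.stronglyMeasurable_innovationNoise k).mono h1).const_smul (a k))

theorem norm_innovationNoise_sq_le (S : SensorNetwork Ω N n d m) (k : ℕ) (ω : Ω) :
    ‖S.innovationNoise k ω‖ ^ 2 ≤ ‖S.gram k ω‖ * ‖S.noise k ω‖ ^ 2 := by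
  have h := Matrix.l2_opNorm_mulVec (S.blockH k ω)ᵀ (S.noise k ω)
  have h1 : ‖(S.blockH k ω)ᵀ‖ = ‖S.blockH k ω‖ := by
    rw [← Matrix.conjTranspose_eq_transpose_of_trivial, Matrix.l2_opNorm_conjTranspose]
  rw [h1] at h
  rw [norm_gram, ← mul_pow]
  exact pow_le_pow_left₀ (norm_nonneg _) h 2

theorem norm_drift_le (S : SensorNetwork Ω N n d m) {a b : ℕ → ℝ} {C : ℝ} (hC : 0 ≤ C)
    {k : ℕ} (ha : 0 ≤ a k) (hb : 0 ≤ b k) (hab : a k ≤ C * b k) (ω : Ω) :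
    ‖Matrix.toEuclideanCLM (𝕜 := ℝ) (S.drift a b k ω)‖ ≤
      b k * ((1 + C) * (1 + (‖S.laplacian k ω‖ + ‖S.gram k ω‖))) := by
  have h1 := l2_opNorm_kronecker_one_le (κ := Fin n) (S.laplacian k ω)
  rw [Matrix.l2_opNorm_toEuclideanCLM, drift]
  calc _ ≤ b k * ‖S.laplacian k ω ⊗ₖ (1 : Matrix (Fin n) (Fin n) ℝ)‖ + a k * ‖S.gram k ω‖ := by
        refine (norm_add_le _ _).trans ?_
        rw [norm_smul, norm_smul, Real.norm_of_nonneg ha, Real.norm_of_nonneg hb]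
    _ ≤ b k * ‖S.laplacian k ω‖ + C * b k * ‖S.gram k ω‖ := by gcongr
    _ = b k * (‖S.laplacian k ω‖ + C * ‖S.gram k ω‖) := by ring
    _ ≤ _ := by
      refine mul_le_mul_of_nonneg_left ?_ hb
      nlinarith [norm_nonneg (S.laplacian k ω), norm_nonneg (S.gram k ω),
        mul_nonneg hC (norm_nonneg (S.laplacian k ω))]

/-- Without delays, the estimates differ from the parameter by the error process. -/
theorem sub_eq_estError (S : SensorNetwork Ω N n d m) {x₀ : Fin n → ℝ} {a b : ℕ → ℝ}
    {ξ : Fin N → Fin n → ℝ} {x : ℤ → Fin N → Ω → Fin n → ℝ} (hx : S.IsEstimate x₀ a b ξ x)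
    {ω : Ω} (hω : ∀ k j i, S.delay k j i ω = 0) (k : ℕ) (i : Fin N) (c : Fin n) :
    x k i ω c = x₀ c + S.estError x₀ a b ξ k ω (i, c) := by
  induction k generalizing i c with
  | zero => simp [hx.init, estError]
  | succ k ih =>
    -- Outside the neighbourhood the weight is zero, so the sum may run over all nodes.
    have h1 : ∑ j ∈ S.neighbors k i ω,
        S.adj k ω i j • (x ((k : ℤ) - ((S.delay k j i ω : ℕ) : ℤ)) j ω - x k i ω)
        = ∑ j, S.adj k ω i j • (x k j ω - x k i ω) := by
      simp only [hω, Fin.val_zero, Nat.cast_zero, sub_zero, neighbors]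
      refine Finset.sum_filter_of_ne fun j _ hj h0 => hj ?_
      rw [h0, zero_smul]
    have h2 : ∀ i c, x k i ω c = x₀ c + S.estError x₀ a b ξ k ω (i, c) := ih
    set e := S.estError x₀ a b ξ k ω with he
    have h3 : ((S.laplacian k ω ⊗ₖ (1 : Matrix (Fin n) (Fin n) ℝ)) *ᵥ e.ofLp) (i, c)
        = (∑ j, S.adj k ω i j) * e (i, c) - ∑ j, S.adj k ω i j * e (j, c) := by
      simp [Matrix.mulVec, dotProduct, Fintype.sum_prod_type, Matrix.one_apply, laplacian,
        Matrix.sub_apply, Matrix.diagonal_apply, sub_mul, Finset.sum_sub_distrib]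
    have h4 : ∀ (p : Fin (m i)), (S.H k i ω *ᵥ x k i ω) p
        = (S.H k i ω *ᵥ x₀) p + (S.blockH k ω *ᵥ e.ofLp) ⟨i, p⟩ := by
      intro p
      simp [Matrix.mulVec, dotProduct, Fintype.sum_prod_type, blockH, h2, mul_add,
        Finset.sum_add_distrib]
    have h5 : ∀ u : (Σ i : Fin N, Fin (m i)) → ℝ, ((S.blockH k ω)ᵀ *ᵥ u) (i, c)
        = ∑ p, S.H k i ω p c * u ⟨i, p⟩ := by
      intro u
      simp only [Matrix.mulVec, dotProduct, Matrix.transpose_apply, Fintype.sum_sigma, blockH,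
        Matrix.of_apply, ite_mul, zero_mul]
      rw [Finset.sum_eq_single i (fun j _ hj => by simp [hj]) (by simp)]
      simp
    have h6 : (S.gram k ω *ᵥ e.ofLp) (i, c)
        = ∑ p, S.H k i ω p c * (S.blockH k ω *ᵥ e.ofLp) ⟨i, p⟩ := by
      rw [gram, ← Matrix.mulVec_mulVec, h5]
    have h7 : S.innovationNoise k ω (i, c) = ∑ p, S.H k i ω p c * S.v k i ω p := h5 _
    have h8 : ((S.H k i ω)ᵀ *ᵥ (S.measurement x₀ k i ω - S.H k i ω *ᵥ x k i ω)) c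
        = ∑ p, S.H k i ω p c * S.v k i ω p
          - ∑ p, S.H k i ω p c * (S.blockH k ω *ᵥ e.ofLp) ⟨i, p⟩ := by
      rw [← Finset.sum_sub_distrib]
      simp only [Matrix.mulVec_eq_sum, measurement]
      simp only [← Matrix.mulVec_eq_sum, Matrix.transpose_transpose]
      simp only [Finset.sum_apply, Pi.smul_apply, Pi.sub_apply, Pi.add_apply, h4]
      refine Finset.sum_congr rfl fun p _ => ?_
      simp
      ring
    have h9 : ∑ j, S.adj k ω i j * (x k j ω c - x k i ω c)
        = ∑ j, S.adj k ω i j * e (j, c) - (∑ j, S.adj k ω i j) * e (i, c) := by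
      simp_rw [h2, Finset.sum_mul, ← Finset.sum_sub_distrib]
      exact Finset.sum_congr rfl fun j _ => by ring
    have h10 : S.estError x₀ a b ξ (k + 1) ω (i, c) = e (i, c)
        - (b k * ((S.laplacian k ω ⊗ₖ (1 : Matrix (Fin n) (Fin n) ℝ)) *ᵥ e.ofLp) (i, c)
          + a k * (S.gram k ω *ᵥ e.ofLp) (i, c)) + a k * S.innovationNoise k ω (i, c) := by
      simp [estError, drift, ← he]
    push_cast
    rw [hx.step, h1, h10, h3, h6, h7]
    simp only [Pi.add_apply, Pi.smul_apply, Finset.sum_apply, Pi.sub_apply, smul_eq_mul]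
    rw [h8, h9, h2]
    ring

/-! ### Moments of the random coefficients -/

variable {μ : Measure Ω}

/-- The size `‖L(k)‖ + ‖𝓗(k)ᵀ 𝓗(k)‖` of the random coefficients at time `k`. -/
def coefSize (S : SensorNetwork Ω N n d m) (k : ℕ) (ω : Ω) : ℝ :=
  ‖S.laplacian k ω‖ + ‖S.gram k ω‖

theorem coefSize_nonneg (S : SensorNetwork Ω N n d m) (k : ℕ) (ω : Ω) : 0 ≤ S.coefSize k ω :=
  add_nonneg (norm_nonneg _) (norm_nonneg _)

theorem stronglyMeasurable_coefSize (S : SensorNetwork Ω N n d m) (k : ℕ) :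
    StronglyMeasurable (S.coefSize k) :=
  ((stronglyMeasurable_matrix (S.measurable_laplacian k)).norm.add
    (stronglyMeasurable_matrix (S.measurable_gram k)).norm).mono (S.modelSigma_le k)

theorem two_le_two_pow_max (h : ℕ) : 2 ≤ 2 ^ max h 2 :=
  le_self_pow₀ one_le_two (by simp)

theorem condExp_coefSize_pow_le {S : SensorNetwork Ω N n d m} {h : ℕ} {ρ₀ : ℝ} (hρ₀ : 0 ≤ ρ₀)
    (hmom : S.BoundedConditionalMoments μ h ρ₀) (k : ℕ) :
    ∀ᵐ ω ∂μ, (μ[fun ω => S.coefSize k ω ^ 2 ^ max h 2 | S.past k]) ω ≤ ρ₀ ^ 2 ^ max h 2 := by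
  have h0 : 0 ≤ᵐ[μ] μ[fun ω => S.coefSize k ω ^ 2 ^ max h 2 | S.past k] :=
    condExp_nonneg (ae_of_all _ fun ω => pow_nonneg (S.coefSize_nonneg k ω) _)
  filter_upwards [h0, (hmom k).2] with ω h1 h2
  have h3 : (1 / (2 : ℝ) ^ max h 2) = ((2 ^ max h 2 : ℕ) : ℝ)⁻¹ := by push_cast; rw [one_div]
  rw [h3] at h2
  have h4 := (Real.rpow_inv_le_iff_of_pos h1 hρ₀ (by positivity)).1 h2
  rwa [Real.rpow_natCast] at h4

theorem integrable_coefSize_sq [IsProbabilityMeasure μ] {S : SensorNetwork Ω N n d m} {h : ℕ}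
    {ρ₀ : ℝ} (hmom : S.BoundedConditionalMoments μ h ρ₀) (k : ℕ) :
    Integrable (fun ω => S.coefSize k ω ^ 2) μ := by
  refine Integrable.mono' ((integrable_const 1).add (hmom k).1)
    ((S.stronglyMeasurable_coefSize k).pow 2).aestronglyMeasurable (ae_of_all _ fun ω => ?_)
  rw [Real.norm_of_nonneg (sq_nonneg _)]
  exact sq_le_one_add_pow (S.coefSize_nonneg k ω) (two_le_two_pow_max h)

/-- The pointwise bound `z ^ 2 ≤ 1 + z ^ q` with `q = 2 ^ max h 2` takes the place of conditional
Jensen, at the price of the additive `1`. -/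
theorem condExp_coefSize_sq_le [IsProbabilityMeasure μ] {S : SensorNetwork Ω N n d m} {h : ℕ}
    {ρ₀ : ℝ} (hρ₀ : 0 ≤ ρ₀) (hmom : S.BoundedConditionalMoments μ h ρ₀) (k : ℕ) :
    ∀ᵐ ω ∂μ, (μ[fun ω => S.coefSize k ω ^ 2 | S.past k]) ω ≤ 1 + ρ₀ ^ 2 ^ max h 2 := by
  have h1 := condExp_mono (m := S.past k) (integrable_coefSize_sq hmom k)
    ((integrable_const (1 : ℝ)).add (hmom k).1)
    (ae_of_all μ fun ω => sq_le_one_add_pow (S.coefSize_nonneg k ω) (two_le_two_pow_max h))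
  filter_upwards [h1, condExp_add (integrable_const (1 : ℝ)) (hmom k).1 (S.past k),
    condExp_coefSize_pow_le hρ₀ hmom k] with ω h2 h3 h4
  refine h2.trans ?_
  rw [h3, Pi.add_apply, condExp_const (S.past_le k)]
  exact add_le_add_right h4 1

theorem integrable_coefSize [IsProbabilityMeasure μ] {S : SensorNetwork Ω N n d m} {h : ℕ}
    {ρ₀ : ℝ} (hmom : S.BoundedConditionalMoments μ h ρ₀) (k : ℕ) :
    Integrable (S.coefSize k) μ := by
  refine Integrable.mono' ((integrable_const 1).add (integrable_coefSize_sq hmom k))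
    (S.stronglyMeasurable_coefSize k).aestronglyMeasurable (ae_of_all _ fun ω => ?_)
  rw [Real.norm_of_nonneg (S.coefSize_nonneg k ω), Pi.add_apply]
  nlinarith [sq_nonneg (S.coefSize k ω - 1)]

theorem setIntegral_coefSize_le [IsProbabilityMeasure μ] {S : SensorNetwork Ω N n d m} {h : ℕ}
    {ρ₀ : ℝ} (hρ₀ : 0 ≤ ρ₀) (hmom : S.BoundedConditionalMoments μ h ρ₀) (k : ℕ) {A : Set Ω}
    (hA : MeasurableSet[S.past k] A) :
    ∫ ω in A, S.coefSize k ω ∂μ ≤ (2 + ρ₀ ^ 2 ^ max h 2) * μ.real A := by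
  have hi := (integrable_const (1 : ℝ)).add (integrable_coefSize_sq hmom k)
  have h1 : ∫ ω in A, S.coefSize k ω ∂μ ≤ μ.real A + ∫ ω in A, S.coefSize k ω ^ 2 ∂μ := by
    refine (integral_mono (integrable_coefSize hmom k).integrableOn hi.integrableOn
      fun ω => ?_).trans_eq ?_
    · simp only [Pi.add_apply]
      nlinarith [sq_nonneg (S.coefSize k ω - 1)]
    · rw [integral_add' (integrable_const _).integrableOn
        (integrable_coefSize_sq hmom k).integrableOn]
      simp
  have h2 : ∫ ω in A, S.coefSize k ω ^ 2 ∂μ ≤ (1 + ρ₀ ^ 2 ^ max h 2) * μ.real A := by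
    rw [← setIntegral_condExp (S.past_le k) (integrable_coefSize_sq hmom k) hA]
    refine (integral_mono_ae integrable_condExp.integrableOn (integrable_const _)
      (ae_restrict_of_ae (condExp_coefSize_sq_le hρ₀ hmom k))).trans_eq ?_
    simp [mul_comm]
  linarith

/-! ### The noise given the model -/

theorem noisePast_le_iSup (S : SensorNetwork Ω N n d m) (k : ℕ) :
    S.noisePast k ≤ ⨆ s, S.noiseSigma s :=
  iSup_le fun s => iSup_le fun _ => le_iSup S.noiseSigma s

/-- The martingale property conditions on data before time `k` only, whereas the noise is multiplied
by `H(k)`. The tower property first reduces the conditioning to past noises; independence then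
allows the whole model, present and future included, to be adjoined. -/
theorem condExp_noise_eq_zero [IsProbabilityMeasure μ] {S : SensorNetwork Ω N n d m}
    (hindep : S.NoiseIndep μ) (hnoise : S.NoiseMartingaleDifference μ) (k : ℕ) (p) :
    μ[fun ω => S.noise k ω p | S.modelNoisePast k] =ᵐ[μ] 0 := by
  have hi := (hnoise.1 k).1
  have hip : Integrable (fun ω => S.noise k ω p) μ :=
    (EuclideanSpace.proj (𝕜 := ℝ) p).integrable_comp hi
  have h1 : μ[fun ω => S.noise k ω p | S.past k] =ᵐ[μ] 0 := by
    have h2 := (EuclideanSpace.proj (𝕜 := ℝ) p).comp_condExp_comm (m := S.past k) hi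
    refine (EventuallyEq.trans ?_ h2.symm).trans ?_
    · rfl
    · filter_upwards [(hnoise.1 k).2] with ω hω
      simp [hω]
  have h3 : μ[fun ω => S.noise k ω p | S.noisePast k] =ᵐ[μ] 0 := by
    refine (condExp_condExp_of_le (S.noisePast_le_past k) (S.past_le k)).symm.trans ?_
    refine (condExp_congr_ae h1).trans ?_
    rw [condExp_zero]
  refine (condExp_sup_eq_of_indep (iSup_le S.noiseSigma_le) (iSup_le S.modelSigma_le)
    (S.noisePast_le_iSup k) hindep ?_ hip).trans h3
  exact ((S.measurable_noise k p).mono (le_iSup S.noiseSigma k) le_rfl).stronglyMeasurable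

/-- Same route as for the mean: down to the past noises, then up by independence. -/
theorem exists_condExp_noise_sq_le [IsProbabilityMeasure μ] {S : SensorNetwork Ω N n d m}
    (hindep : S.NoiseIndep μ) (hnoise : S.NoiseMartingaleDifference μ) :
    ∃ β, 0 ≤ β ∧ ∀ k, Integrable (fun ω => ‖S.noise k ω‖ ^ 2) μ ∧
      ∀ᵐ ω ∂μ, (μ[fun ω => ‖S.noise k ω‖ ^ 2 | S.modelNoisePast k]) ω ≤ β := by
  obtain ⟨β, hβ, hn⟩ := hnoise.2
  refine ⟨β, hβ.le, fun k => ⟨(hn k).1, ?_⟩⟩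
  have h1 := condExp_sup_eq_of_indep (iSup_le S.noiseSigma_le) (iSup_le S.modelSigma_le)
    (S.noisePast_le_iSup k) hindep
    (((S.stronglyMeasurable_noise k).norm.pow 2).mono (le_iSup S.noiseSigma k)) (hn k).1
  have h2 := condExp_condExp_of_le (μ := μ) (f := fun ω => ‖S.noise k ω‖ ^ 2)
    (S.noisePast_le_past k) (S.past_le k)
  have h3 := condExp_mono (m := S.noisePast k) integrable_condExp (integrable_const β) (hn k).2
  rw [condExp_const ((S.noisePast_le_past k).trans (S.past_le k))] at h3
  filter_upwards [h1, h2, h3] with ω e1 e2 e3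
  have e4 : (μ[fun ω => ‖S.noise k ω‖ ^ 2 | S.modelNoisePast k]) ω
      = (μ[fun ω => ‖S.noise k ω‖ ^ 2 | S.noisePast k]) ω := e1
  rw [e4, ← e2]
  exact e3

theorem stronglyMeasurable_norm_gram (S : SensorNetwork Ω N n d m) (k : ℕ) :
    StronglyMeasurable[S.modelNoisePast k] fun ω => ‖S.gram k ω‖ :=
  (stronglyMeasurable_matrix (S.measurable_gram k)).norm.mono (S.modelSigma_le_modelNoisePast k)

theorem norm_gram_le_coefSize (S : SensorNetwork Ω N n d m) (k : ℕ) (ω : Ω) :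
    ‖S.gram k ω‖ ≤ S.coefSize k ω :=
  le_add_of_nonneg_left (norm_nonneg _)

theorem integrable_norm_gram [IsProbabilityMeasure μ] {S : SensorNetwork Ω N n d m} {h : ℕ}
    {ρ₀ : ℝ} (hmom : S.BoundedConditionalMoments μ h ρ₀) (k : ℕ) :
    Integrable (fun ω => ‖S.gram k ω‖) μ :=
  Integrable.mono' (integrable_coefSize hmom k)
    ((S.stronglyMeasurable_norm_gram k).mono (S.modelNoisePast_le k)).aestronglyMeasurable
    (ae_of_all _ fun ω => by rw [norm_norm]; exact S.norm_gram_le_coefSize k ω)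

/-- `‖𝓗ᵀ v‖² ≤ ‖𝓗ᵀ 𝓗‖ ‖v‖²`, and the first factor is a function of the model, so it can be pulled
out of the conditional second moment of the noise. -/
theorem integrable_and_setIntegral_innovationNoise_le [IsProbabilityMeasure μ]
    {S : SensorNetwork Ω N n d m} {h : ℕ} {ρ₀ β : ℝ} (hρ₀ : 0 ≤ ρ₀)
    (hmom : S.BoundedConditionalMoments μ h ρ₀) (hβ : 0 ≤ β) {k : ℕ}
    (hi : Integrable (fun ω => ‖S.noise k ω‖ ^ 2) μ)
    (hc : ∀ᵐ ω ∂μ, (μ[fun ω => ‖S.noise k ω‖ ^ 2 | S.modelNoisePast k]) ω ≤ β) :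
    Integrable (fun ω => ‖S.innovationNoise k ω‖ ^ 2) μ ∧ ∀ A, MeasurableSet[S.past k] A →
      ∫ ω in A, ‖S.innovationNoise k ω‖ ^ 2 ∂μ ≤ β * (2 + ρ₀ ^ 2 ^ max h 2) * μ.real A := by
  have hG := integrable_norm_gram hmom k
  have h1 := (integrable_mul_and_integral_mul_le_of_condExp_le (S.modelNoisePast_le k)
    (S.stronglyMeasurable_norm_gram k) (fun ω => norm_nonneg _) hG
    (fun ω => sq_nonneg _) hi hc).1
  have hw : Integrable (fun ω => ‖S.innovationNoise k ω‖ ^ 2) μ := by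
    refine Integrable.mono' h1 (((S.stronglyMeasurable_innovationNoise k).mono
      (sup_le (S.noiseSigma_le k) (S.modelSigma_le k))).norm.pow 2).aestronglyMeasurable
      (ae_of_all _ fun ω => ?_)
    rw [Real.norm_of_nonneg (sq_nonneg _)]
    exact S.norm_innovationNoise_sq_le k ω
  refine ⟨hw, fun A hA => ?_⟩
  have hA' := S.past_le_modelNoisePast k A hA
  have hA'' := S.past_le k A hA
  have h2 := (integrable_mul_and_integral_mul_le_of_condExp_le (S.modelNoisePast_le k)
    ((S.stronglyMeasurable_norm_gram k).indicator hA')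
    (Set.indicator_nonneg fun ω _ => norm_nonneg _) (hG.indicator hA'')
    (fun ω => sq_nonneg _) hi hc).2
  rw [integral_indicator hA''] at h2
  have h3 : ∫ ω in A, ‖S.innovationNoise k ω‖ ^ 2 ∂μ
      ≤ ∫ ω, A.indicator (fun ω => ‖S.gram k ω‖) ω * ‖S.noise k ω‖ ^ 2 ∂μ := by
    refine (integral_mono hw.integrableOn h1.integrableOn
      (S.norm_innovationNoise_sq_le k)).trans_eq ?_
    rw [← integral_indicator hA'']
    refine integral_congr_ae (ae_of_all _ fun ω => ?_)
    by_cases hω : ω ∈ A <;> simp [hω]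
  have h4 : ∫ ω in A, ‖S.gram k ω‖ ∂μ ≤ ∫ ω in A, S.coefSize k ω ∂μ :=
    integral_mono hG.integrableOn (integrable_coefSize hmom k).integrableOn
      (S.norm_gram_le_coefSize k)
  calc _ ≤ _ := h3
    _ ≤ _ := h2
    _ ≤ β * ((2 + ρ₀ ^ 2 ^ max h 2) * μ.real A) := by
      gcongr
      exact h4.trans (setIntegral_coefSize_le hρ₀ hmom k hA)
    _ = _ := by ring

/-- The noise of the error dynamics is orthogonal to square integrable vectors that are functions
of the model and of the past noises. -/
theorem setIntegral_inner_innovationNoise_eq_zero [IsProbabilityMeasure μ]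
    {S : SensorNetwork Ω N n d m} {h : ℕ} {ρ₀ β : ℝ}
    (hmom : S.BoundedConditionalMoments μ h ρ₀) (hindep : S.NoiseIndep μ)
    (hnoise : S.NoiseMartingaleDifference μ) {k : ℕ}
    (hi : Integrable (fun ω => ‖S.noise k ω‖ ^ 2) μ)
    (hc : ∀ᵐ ω ∂μ, (μ[fun ω => ‖S.noise k ω‖ ^ 2 | S.modelNoisePast k]) ω ≤ β)
    {X : Ω → EuclideanSpace ℝ (Fin N × Fin n)} (hX : StronglyMeasurable[S.modelNoisePast k] X)
    (hXi : Integrable (fun ω => ‖X ω‖ ^ 2) μ) {A : Set Ω} (hA : MeasurableSet[S.past k] A) :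
    ∫ ω in A, inner ℝ (X ω) (S.innovationNoise k ω) ∂μ = 0 := by
  -- Moving `𝓗ᵀ` across, `⟨X, 𝓗ᵀ v⟩ = ⟨𝓗 X, v⟩`; `F p` is a coordinate of `𝓗 X` cut off to `A`,
  -- measurable for the conditioning σ-algebra.
  let F : (Σ i : Fin N, Fin (m i)) → Ω → ℝ := fun p =>
    A.indicator fun ω => (S.blockH k ω *ᵥ (X ω).ofLp) p
  have hA' := S.past_le_modelNoisePast k A hA
  have hA'' := S.past_le k A hA
  have hXm : ∀ q, Measurable[S.modelNoisePast k] fun ω => X ω q := fun q =>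
    ((EuclideanSpace.proj (𝕜 := ℝ) q).continuous.comp_stronglyMeasurable hX).measurable
  have hFm : ∀ p, StronglyMeasurable[S.modelNoisePast k] (F p) := by
    intro p
    refine StronglyMeasurable.indicator (Measurable.stronglyMeasurable ?_) hA'
    simp only [Matrix.mulVec, dotProduct]
    exact Finset.measurable_sum _ fun q _ =>
      ((S.measurable_blockH k p q).mono (S.modelSigma_le_modelNoisePast k) le_rfl).mul (hXm q)
  have hFle : ∀ p ω, |F p ω| ≤ ‖S.gram k ω‖ + ‖X ω‖ ^ 2 := by
    intro p ω
    have h1 : |F p ω| ≤ |(S.blockH k ω *ᵥ (X ω).ofLp) p| := by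
      by_cases hω : ω ∈ A <;> simp [F, hω]
    have h2 := PiLp.norm_apply_le ((EuclideanSpace.equiv _ ℝ).symm
      (S.blockH k ω *ᵥ (X ω).ofLp)) p
    have h3 := Matrix.l2_opNorm_mulVec (S.blockH k ω) (X ω)
    have h4 : |(S.blockH k ω *ᵥ (X ω).ofLp) p| ≤ ‖S.blockH k ω‖ * ‖X ω‖ := h2.trans h3
    rw [norm_gram]
    nlinarith [sq_nonneg (‖S.blockH k ω‖ - ‖X ω‖), sq_nonneg ‖S.blockH k ω‖, sq_nonneg ‖X ω‖]
  have hFi : ∀ p, Integrable (F p) μ := fun p =>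
    Integrable.mono' ((integrable_norm_gram hmom k).add hXi)
      ((hFm p).mono (S.modelNoisePast_le k)).aestronglyMeasurable (ae_of_all _ (hFle p))
  have hvm : ∀ p, StronglyMeasurable fun ω => S.noise k ω p := fun p =>
    ((S.measurable_noise k p).mono (S.noiseSigma_le k) le_rfl).stronglyMeasurable
  have hvi : ∀ p, Integrable (fun ω => S.noise k ω p) μ := fun p =>
    (EuclideanSpace.proj (𝕜 := ℝ) p).integrable_comp (hnoise.1 k).1
  -- Uses `|v_p| ≤ 1 + ‖v‖²` and the pull-out lemma for `|F p| * ‖v‖²`.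
  have hFv : ∀ p, Integrable (F p * fun ω => S.noise k ω p) μ := by
    intro p
    have h1 := (integrable_mul_and_integral_mul_le_of_condExp_le (S.modelNoisePast_le k)
      (hFm p).norm (fun ω => norm_nonneg _) (hFi p).norm (fun ω => sq_nonneg _) hi hc).1
    refine Integrable.mono' ((hFi p).norm.add h1)
      (((hFm p).mono (S.modelNoisePast_le k)).mul (hvm p)).aestronglyMeasurable
      (ae_of_all _ fun ω => ?_)
    have h2 : ‖S.noise k ω p‖ ≤ ‖S.noise k ω‖ := PiLp.norm_apply_le _ p
    have h3 : ‖S.noise k ω p‖ ≤ 1 + ‖S.noise k ω‖ ^ 2 := by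
      nlinarith [sq_nonneg (‖S.noise k ω‖ - 1)]
    rw [Pi.mul_apply, norm_mul, Pi.add_apply]
    nlinarith [mul_le_mul_of_nonneg_left h3 (norm_nonneg (F p ω))]
  have hzero : ∀ p, ∫ ω, (F p * fun ω => S.noise k ω p) ω ∂μ = 0 := by
    intro p
    rw [← integral_condExp (S.modelNoisePast_le k)]
    refine integral_eq_zero_of_ae ((condExp_mul_of_stronglyMeasurable_left (hFm p) (hFv p)
      (hvi p)).trans ?_)
    filter_upwards [condExp_noise_eq_zero hindep hnoise k p] with ω hω
    simp [hω]
  rw [← integral_indicator hA'']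
  have hsum : ∀ ω, A.indicator (fun ω => inner ℝ (X ω) (S.innovationNoise k ω)) ω
      = ∑ p, (F p * fun ω => S.noise k ω p) ω := by
    intro ω
    by_cases hω : ω ∈ A
    · have h1 : inner ℝ (X ω) (S.innovationNoise k ω)
          = (S.blockH k ω *ᵥ (X ω).ofLp) ⬝ᵥ (S.noise k ω).ofLp := by
        rw [EuclideanSpace.inner_eq_star_dotProduct, innovationNoise, star_trivial,
          Matrix.mulVec_transpose, ← Matrix.dotProduct_mulVec, dotProduct_comm]
      simp only [Set.indicator_of_mem hω, h1, F, Pi.mul_apply, dotProduct]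
    · simp [F, hω]
  simp_rw [hsum]
  rw [integral_finsetSum _ fun p _ => hFv p]
  exact Finset.sum_eq_zero fun p _ => hzero p

/-! ### The error process as a random linear recursion -/

/-- The size of the drift operators relative to the consensus gain. -/
def driftSize (S : SensorNetwork Ω N n d m) (C : ℝ) (k : ℕ) (ω : Ω) : ℝ :=
  (1 + C) * (1 + S.coefSize k ω)

theorem driftSize_sq_le (S : SensorNetwork Ω N n d m) (C : ℝ) (k : ℕ) (ω : Ω) :
    S.driftSize C k ω ^ 2 ≤ (1 + C) ^ 2 * (2 + 2 * S.coefSize k ω ^ 2) := by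
  rw [driftSize, mul_pow]
  gcongr
  nlinarith [sq_nonneg (S.coefSize k ω - 1)]

theorem integrable_driftSize_sq [IsProbabilityMeasure μ] {S : SensorNetwork Ω N n d m} {h : ℕ}
    {ρ₀ : ℝ} (hmom : S.BoundedConditionalMoments μ h ρ₀) (C : ℝ) (k : ℕ) :
    Integrable (fun ω => S.driftSize C k ω ^ 2) μ := by
  refine Integrable.mono' (((integrable_const 2).add
    ((integrable_coefSize_sq hmom k).const_mul 2)).const_mul ((1 + C) ^ 2))
    (((stronglyMeasurable_const.add (S.stronglyMeasurable_coefSize k)).const_mul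
      (1 + C)).pow 2).aestronglyMeasurable (ae_of_all _ fun ω => ?_)
  rw [Real.norm_of_nonneg (sq_nonneg _)]
  exact S.driftSize_sq_le C k ω

theorem condExp_driftSize_sq_le [IsProbabilityMeasure μ] {S : SensorNetwork Ω N n d m} {h : ℕ}
    {ρ₀ : ℝ} (hρ₀ : 0 ≤ ρ₀) (hmom : S.BoundedConditionalMoments μ h ρ₀) (C : ℝ) (k : ℕ) :
    ∀ᵐ ω ∂μ, (μ[fun ω => S.driftSize C k ω ^ 2 | S.past k]) ω ≤
      (1 + C) ^ 2 * (2 + 2 * (1 + ρ₀ ^ 2 ^ max h 2)) := by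
  have hZ := integrable_coefSize_sq hmom k
  have hi := (integrable_const (μ := μ) (2 : ℝ)).add (hZ.smul (2 : ℝ))
  have h1 := condExp_mono (m := S.past k) (integrable_driftSize_sq hmom C k)
    (hi.smul ((1 + C) ^ 2)) (ae_of_all μ (S.driftSize_sq_le C k))
  filter_upwards [h1, condExp_smul ((1 + C) ^ 2) ((fun _ => (2 : ℝ)) +
      (2 : ℝ) • fun ω => S.coefSize k ω ^ 2) (S.past k) (μ := μ),
    condExp_add (integrable_const (μ := μ) (2 : ℝ)) (hZ.smul (2 : ℝ)) (S.past k),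
    condExp_smul (2 : ℝ) (fun ω => S.coefSize k ω ^ 2) (S.past k) (μ := μ),
    condExp_coefSize_sq_le hρ₀ hmom k] with ω e1 e2 e3 e4 e5
  refine e1.trans ?_
  refine (le_of_eq e2).trans ?_
  rw [Pi.smul_apply, smul_eq_mul, e3, Pi.add_apply, e4, Pi.smul_apply, smul_eq_mul,
    condExp_const (S.past_le k)]
  gcongr

/-- The error process is driven by a linear recursion with conditionally bounded coefficients and
orthogonal noise. -/
theorem exists_randomLinearRecursion [IsProbabilityMeasure μ] {S : SensorNetwork Ω N n d m}
    (x₀ : Fin n → ℝ) {a b : ℕ → ℝ} (ξ : Fin N → Fin n → ℝ) (hindep : S.NoiseIndep μ)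
    (hnoise : S.NoiseMartingaleDifference μ) (hgain : GainCondition a b) {h : ℕ} {ρ₀ : ℝ}
    (hρ₀ : 0 ≤ ρ₀) (hmom : S.BoundedConditionalMoments μ h ρ₀) :
    ∃ Y ρ K, RandomLinearRecursion μ S.pastFiltration a b (S.estError x₀ a b ξ)
      (fun k ω => Matrix.toEuclideanCLM (𝕜 := ℝ) (S.drift a b k ω)) S.innovationNoise Y ρ K := by
  obtain ⟨C, hC, hab⟩ := hgain.exists_a_le_mul_b
  obtain ⟨β, hβ, hn⟩ := exists_condExp_noise_sq_le hindep hnoise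
  have hdrift : ∀ k ω, ‖Matrix.toEuclideanCLM (𝕜 := ℝ) (S.drift a b k ω)‖
      ≤ b k * S.driftSize C k ω := fun k ω =>
    S.norm_drift_le hC.le (hgain.a_pos k).le (hgain.b_pos k).le (hab k) ω
  -- With `a ≤ C * b`, both parts of the drift are of size `b`. The second constant comes from `(1 +
  -- z) ^ 2 ≤ 2 + 2 * z ^ 2`; the third is the noise bound `β` times the bound on the mean of
  -- `coefSize`.
  refine ⟨S.driftSize C, (1 + C) ^ 2 * (2 + 2 * (1 + ρ₀ ^ 2 ^ max h 2)),
    β * (2 + ρ₀ ^ 2 ^ max h 2), ?_⟩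
  have hw := fun k =>
    integrable_and_setIntegral_innovationNoise_le hρ₀ hmom hβ (hn k).1 (hn k).2
  exact
    { integrable_init := by
        simp only [estError]
        exact integrable_const _
      step := fun _ _ => rfl
      measurable_e := S.stronglyMeasurable_estError x₀ a b ξ
      measurable_D := fun k =>
        (stronglyMeasurable_toEuclideanCLM (S.measurable_drift a b k)).mono (S.modelSigma_le k)
      measurable_w := fun k => (S.stronglyMeasurable_innovationNoise k).mono
        (sup_le (S.noiseSigma_le k) (S.modelSigma_le k))
      norm_D_le := hdrift
      one_le_Y := fun k ω => by
        have := S.coefSize_nonneg k ω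
        rw [driftSize]
        nlinarith [mul_nonneg hC.le this]
      integrable_Y := integrable_driftSize_sq hmom C
      condExp_Y := condExp_driftSize_sq_le hρ₀ hmom C
      integrable_w := fun k => (hw k).1
      integral_w := fun k => (hw k).2
      orthogonal := fun k hV A hA => by
        have he := S.stronglyMeasurable_estError x₀ a b ξ k
        -- This vector involves `H(k)` and `L(k)` besides the past, hence the conditioning on the
        -- whole model.
        have hX : StronglyMeasurable[S.modelNoisePast k] fun ω => S.estError x₀ a b ξ k ω
            - Matrix.toEuclideanCLM (𝕜 := ℝ) (S.drift a b k ω) (S.estError x₀ a b ξ k ω) :=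
          (he.mono (S.past_le_modelNoisePast k)).sub (stronglyMeasurable_toEuclideanCLM_apply
            (fun p q => (S.measurable_drift a b k p q).mono (S.modelSigma_le_modelNoisePast k)
              le_rfl) (he.mono (S.past_le_modelNoisePast k)))
        refine setIntegral_inner_innovationNoise_eq_zero hmom hindep hnoise (hn k).1 (hn k).2 hX
          ?_ hA
        have h1 := (integrable_mul_and_integral_mul_le_of_condExp_le (S.past_le k)
          (he.norm.pow 2) (fun ω => sq_nonneg _) hV (fun ω => sq_nonneg _)
          (integrable_driftSize_sq hmom C k) (condExp_driftSize_sq_le hρ₀ hmom C k)).1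
        refine Integrable.mono' ((hV.const_mul 2).add (h1.const_mul (2 * b k ^ 2)))
          ((hX.mono (S.modelNoisePast_le k)).norm.pow 2).aestronglyMeasurable
          (ae_of_all _ fun ω => ?_)
        set y := S.estError x₀ a b ξ k ω with hy
        set T := Matrix.toEuclideanCLM (𝕜 := ℝ) (S.drift a b k ω)
        have h2 : ‖T y‖ ^ 2 ≤ (b k * S.driftSize C k ω * ‖y‖) ^ 2 :=
          pow_le_pow_left₀ (norm_nonneg _) (T.le_of_opNorm_le (hdrift k ω) y) 2
        have h3 := norm_sub_le y (T y)
        rw [Real.norm_of_nonneg (sq_nonneg _)]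
        simp only [Pi.add_apply, Pi.pow_apply, ← hy]
        nlinarith [sq_nonneg (‖y‖ - ‖T y‖), norm_nonneg (y - T y)]
      ρ_nonneg := by positivity
      K_nonneg := by positivity
      b_pos := hgain.b_pos }

/-! ### Information matrices and persistence of excitation -/

theorem measurable_symLaplacian (S : SensorNetwork Ω N n d m) (k : ℕ) (i j) :
    Measurable fun ω => S.symLaplacian k ω i j := by
  simp only [symLaplacian, Matrix.smul_apply, Matrix.add_apply, Matrix.transpose_apply,
    smul_eq_mul]
  exact (((S.measurable_laplacian k i j).add (S.measurable_laplacian k j i)).const_mul _).mono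
    (S.modelSigma_le k) le_rfl

theorem abs_symLaplacian_le (S : SensorNetwork Ω N n d m) (k : ℕ) (ω : Ω) (i j) :
    |S.symLaplacian k ω i j| ≤ S.coefSize k ω := by
  have h1 := abs_entry_le_l2_opNorm (S.laplacian k ω) i j
  have h2 := abs_entry_le_l2_opNorm (S.laplacian k ω) j i
  have h3 := abs_add_le (S.laplacian k ω i j) (S.laplacian k ω j i)
  have h4 : S.symLaplacian k ω i j
      = 1 / 2 * (S.laplacian k ω i j + S.laplacian k ω j i) := by simp [symLaplacian]
  rw [h4, abs_mul, abs_of_pos (by norm_num : (0 : ℝ) < 1 / 2), coefSize]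
  linarith [norm_nonneg (S.gram k ω)]

theorem abs_gram_le (S : SensorNetwork Ω N n d m) (k : ℕ) (ω : Ω) (p q) :
    |S.gram k ω p q| ≤ S.coefSize k ω :=
  (abs_entry_le_l2_opNorm _ p q).trans (S.norm_gram_le_coefSize k ω)

/-- The information `(b / a) L̂ ⊗ I + 𝓗ᵀ 𝓗` collected at time `k`. -/
def information (S : SensorNetwork Ω N n d m) (r : ℝ) (k : ℕ) (ω : Ω) :
    Matrix (Fin N × Fin n) (Fin N × Fin n) ℝ :=
  r • (S.symLaplacian k ω ⊗ₖ (1 : Matrix (Fin n) (Fin n) ℝ)) + S.gram k ω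

/-- The antisymmetric part of `L ⊗ I` drops out of the quadratic form; dividing by `a` produces the
ratio `b / a` of the excitation condition. -/
theorem dotProduct_drift (S : SensorNetwork Ω N n d m) {a b : ℕ → ℝ} {k : ℕ} (ha : a k ≠ 0)
    (ω : Ω) (x : Fin N × Fin n → ℝ) :
    (a k)⁻¹ * (x ⬝ᵥ S.drift a b k ω *ᵥ x) = x ⬝ᵥ S.information (b k / a k) k ω *ᵥ x := by
  have hT : ∀ M : Matrix (Fin N × Fin n) (Fin N × Fin n) ℝ, x ⬝ᵥ Mᵀ *ᵥ x = x ⬝ᵥ M *ᵥ x := by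
    intro M
    rw [Matrix.mulVec_transpose, dotProduct_comm, ← Matrix.dotProduct_mulVec]
  have hsym : S.symLaplacian k ω ⊗ₖ (1 : Matrix (Fin n) (Fin n) ℝ)
      = (1 / 2 : ℝ) • (S.laplacian k ω ⊗ₖ (1 : Matrix (Fin n) (Fin n) ℝ)
        + (S.laplacian k ω ⊗ₖ (1 : Matrix (Fin n) (Fin n) ℝ))ᵀ) := by
    rw [symLaplacian, Matrix.smul_kronecker, Matrix.add_kronecker, ← Matrix.kroneckerMap_transpose,
      Matrix.transpose_one]
  rw [drift, information, hsym]
  simp only [Matrix.add_mulVec, Matrix.smul_mulVec, dotProduct_add, dotProduct_smul, hT,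
    smul_eq_mul]
  field_simp
  ring

theorem integrable_symLaplacian [IsProbabilityMeasure μ] {S : SensorNetwork Ω N n d m} {h : ℕ}
    {ρ₀ : ℝ} (hmom : S.BoundedConditionalMoments μ h ρ₀) (k : ℕ) (i j) :
    Integrable (fun ω => S.symLaplacian k ω i j) μ :=
  Integrable.mono' (integrable_coefSize hmom k) (S.measurable_symLaplacian k i j).aestronglyMeasurable
    (ae_of_all _ fun ω => S.abs_symLaplacian_le k ω i j)

theorem integrable_gram [IsProbabilityMeasure μ] {S : SensorNetwork Ω N n d m} {h : ℕ}
    {ρ₀ : ℝ} (hmom : S.BoundedConditionalMoments μ h ρ₀) (k : ℕ) (p q) :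
    Integrable (fun ω => S.gram k ω p q) μ :=
  Integrable.mono' (integrable_coefSize hmom k)
    ((S.measurable_gram k p q).mono (S.modelSigma_le k) le_rfl).aestronglyMeasurable
    (ae_of_all _ fun ω => S.abs_gram_le k ω p q)

theorem information_apply (S : SensorNetwork Ω N n d m) (r : ℝ) (k : ℕ) (p q) :
    (fun ω => S.information r k ω p q)
      = (r * (1 : Matrix (Fin n) (Fin n) ℝ) p.2 q.2) • (fun ω => S.symLaplacian k ω p.1 q.1)
        + fun ω => S.gram k ω p q := by
  ext ω
  simp [information]
  ring

theorem integrable_information [IsProbabilityMeasure μ] {S : SensorNetwork Ω N n d m} {h : ℕ}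
    {ρ₀ : ℝ} (hmom : S.BoundedConditionalMoments μ h ρ₀) (r : ℝ) (k : ℕ) (p q) :
    Integrable (fun ω => S.information r k ω p q) μ := by
  rw [information_apply]
  exact ((integrable_symLaplacian hmom k _ _).smul _).add (integrable_gram hmom k p q)

theorem abs_information_le (S : SensorNetwork Ω N n d m) (r : ℝ) (k : ℕ) (ω : Ω) (p q) :
    |S.information r k ω p q| ≤ (|r| + 1) * S.coefSize k ω := by
  have h1 := S.abs_symLaplacian_le k ω p.1 q.1
  have h2 := S.abs_gram_le k ω p q
  have h3 : |r * (1 : Matrix (Fin n) (Fin n) ℝ) p.2 q.2| ≤ |r| := by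
    rw [Matrix.one_apply]
    split_ifs <;> simp
  have h4 := congrFun (S.information_apply r k p q) ω
  simp only [Pi.add_apply, Pi.smul_apply, smul_eq_mul] at h4
  rw [h4]
  refine (abs_add_le _ _).trans ?_
  rw [abs_mul]
  have := mul_le_mul h3 h1 (abs_nonneg _) (abs_nonneg _)
  linarith

theorem condExpMatrix_information [IsProbabilityMeasure μ] {S : SensorNetwork Ω N n d m} {h : ℕ}
    {ρ₀ : ℝ} (hmom : S.BoundedConditionalMoments μ h ρ₀) (l : ℕ) (r : ℝ) (k : ℕ)
    (p q) : ∀ᵐ ω ∂μ, condExpMatrix μ (S.past l) (S.information r k) ω p q =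
      (r • (condExpMatrix μ (S.past l) (S.symLaplacian k) ω ⊗ₖ (1 : Matrix (Fin n) (Fin n) ℝ))
        + condExpMatrix μ (S.past l) (S.gram k) ω) p q := by
  have h1 := condExp_add ((integrable_symLaplacian hmom k p.1 q.1).smul
    (r * (1 : Matrix (Fin n) (Fin n) ℝ) p.2 q.2)) (integrable_gram hmom k p q) (S.past l)
  have h2 := condExp_smul (μ := μ) (r * (1 : Matrix (Fin n) (Fin n) ℝ) p.2 q.2)
    (fun ω => S.symLaplacian k ω p.1 q.1) (S.past l)
  filter_upwards [h1, h2] with ω e1 e2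
  simp only [condExpMatrix, Matrix.of_apply, Matrix.add_apply, Matrix.smul_apply,
    Matrix.kroneckerMap_apply, smul_eq_mul]
  rw [information_apply, e1, Pi.add_apply, e2, Pi.smul_apply, smul_eq_mul]
  ring

theorem symLaplacian_isHermitian (S : SensorNetwork Ω N n d m) (k : ℕ) (ω : Ω) :
    (S.symLaplacian k ω).IsHermitian := by
  ext i j
  simp [symLaplacian]
  ring

theorem gram_isHermitian (S : SensorNetwork Ω N n d m) (k : ℕ) (ω : Ω) :
    (S.gram k ω).IsHermitian := by
  rw [gram, ← Matrix.conjTranspose_eq_transpose_of_trivial]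
  exact Matrix.isHermitian_conjTranspose_mul_self _

/-- Persistence of excitation in integrated form, for the error process. -/
theorem mul_setIntegral_le_sum_drift [IsProbabilityMeasure μ] {S : SensorNetwork Ω N n d m}
    {a b : ℕ → ℝ} (hgain : GainCondition a b) {h : ℕ} {ρ₀ θ : ℝ}
    (hexc : S.PersistentlyExciting μ a b h θ) (hρ₀ : 0 ≤ ρ₀)
    (hmom : S.BoundedConditionalMoments μ h ρ₀)
    {e : Ω → EuclideanSpace ℝ (Fin N × Fin n)} (j : ℕ) (he : StronglyMeasurable[S.past (j * h)] e)
    (hV : Integrable (fun ω => ‖e ω‖ ^ 2) μ) {A : Set Ω} (hA : MeasurableSet[S.past (j * h)] A) :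
    θ * ∫ ω in A, ‖e ω‖ ^ 2 ∂μ ≤ ∑ i ∈ Finset.range h, (a (j * h + i))⁻¹ *
      ∫ ω in A, inner ℝ (e ω)
        (Matrix.toEuclideanCLM (𝕜 := ℝ) (S.drift a b (j * h + i) ω) (e ω)) ∂μ := by
  let P : ℕ → Ω → Matrix (Fin N × Fin n) (Fin N × Fin n) ℝ := fun k ω =>
    (b k / a k) • (condExpMatrix μ (S.past (j * h)) (S.symLaplacian k) ω
      ⊗ₖ (1 : Matrix (Fin n) (Fin n) ℝ)) + condExpMatrix μ (S.past (j * h)) (S.gram k) ω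
  have hPherm : ∀ k ω, (P k ω).IsHermitian := by
    intro k ω
    refine Matrix.IsHermitian.add ?_ (condExpMatrix_isHermitian _ _ (S.gram_isHermitian k) ω)
    have h1 := condExpMatrix_isHermitian μ (S.past (j * h)) (S.symLaplacian_isHermitian k) ω
    rw [Matrix.IsHermitian, Matrix.conjTranspose_smul, Matrix.conjTranspose_kronecker, h1.eq,
      Matrix.conjTranspose_one, star_trivial]
  have hep : ∀ p, StronglyMeasurable[S.past (j * h)] fun ω => (e ω).ofLp p := fun p =>
    (EuclideanSpace.proj (𝕜 := ℝ) p).continuous.comp_stronglyMeasurable he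
  have hterm : ∀ i ∈ Finset.range h,
      IntegrableOn (fun ω => (e ω).ofLp ⬝ᵥ P (j * h + i) ω *ᵥ (e ω).ofLp) A μ ∧
      (a (j * h + i))⁻¹ * ∫ ω in A, inner ℝ (e ω)
        (Matrix.toEuclideanCLM (𝕜 := ℝ) (S.drift a b (j * h + i) ω) (e ω)) ∂μ
      = ∫ ω in A, (e ω).ofLp ⬝ᵥ P (j * h + i) ω *ᵥ (e ω).ofLp ∂μ := by
    intro i _
    set k := j * h + i
    have hpk : S.past (j * h) ≤ S.past k := S.pastFiltration.mono (Nat.le_add_right _ _)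
    -- The moment bound at time `k` is conditional on `S.past k`, which contains the past at the
    -- start of the window, where `e` is measurable.
    have hY := (integrable_mul_and_integral_mul_le_of_condExp_le (S.past_le k)
      ((he.mono hpk).norm.pow 2) (fun ω => sq_nonneg _) hV (fun ω => sq_nonneg _)
      (integrable_coefSize_sq hmom k) (condExp_coefSize_sq_le hρ₀ hmom k)).1
    have hxM : ∀ p q, Integrable (fun ω => (e ω).ofLp p * (e ω).ofLp q
        * S.information (b k / a k) k ω p q) μ := by
      intro p q
      refine Integrable.mono' ((hV.add hY).const_mul (|b k / a k| + 1))
        ((((hep p).mul (hep q)).mono (S.past_le _)).aestronglyMeasurable.mul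
          (integrable_information hmom (b k / a k) k p q).aestronglyMeasurable)
        (ae_of_all _ fun ω => ?_)
      have h1 : ‖(e ω).ofLp p‖ ≤ ‖e ω‖ := PiLp.norm_apply_le _ p
      have h2 : ‖(e ω).ofLp q‖ ≤ ‖e ω‖ := PiLp.norm_apply_le _ q
      have h3 := S.abs_information_le (b k / a k) k ω p q
      have h4 : S.coefSize k ω ≤ 1 + S.coefSize k ω ^ 2 := by
        nlinarith [sq_nonneg (S.coefSize k ω - 1)]
      have h5 : ‖S.information (b k / a k) k ω p q‖
          ≤ (|b k / a k| + 1) * (1 + S.coefSize k ω ^ 2) :=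
        h3.trans (by gcongr)
      rw [norm_mul, norm_mul]
      calc _ ≤ ‖e ω‖ * ‖e ω‖ * ((|b k / a k| + 1) * (1 + S.coefSize k ω ^ 2)) := by gcongr
        _ = _ := by
          simp only [Pi.add_apply, Pi.pow_apply]
          ring
    -- Conditioning on the start of the window replaces the random information matrix by the matrix
    -- of the excitation condition.
    have hq := integrable_and_setIntegral_condExpMatrix (μ := μ) (S.past_le (j * h)) hep
      (integrable_information hmom (b k / a k) k) hxM
      (condExpMatrix_information hmom (j * h) (b k / a k) k) hA
    refine ⟨hq.1, ?_⟩
    rw [← integral_const_mul]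
    refine Eq.trans (integral_congr_ae (ae_of_all _ fun ω => ?_)) hq.2
    simp only [Matrix.inner_toEuclideanCLM]
    exact S.dotProduct_drift (hgain.a_pos k).ne' ω _
  rw [Finset.sum_congr rfl fun i hi => (hterm i hi).2,
    ← integral_finsetSum _ fun i hi => (hterm i hi).1, ← integral_const_mul]
  refine integral_mono_ae (hV.const_mul θ).integrableOn
    (integrable_finsetSum _ fun i hi => (hterm i hi).1) (ae_restrict_of_ae ?_)
  -- The eigenvalue bound concerns the sum over the window and not its terms, so it is applied
  -- pointwise only after summation.
  filter_upwards [hexc] with ω hω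
  have h1 : θ ≤ lambdaMin (∑ k ∈ Finset.Ico (j * h) ((j + 1) * h), P k ω) := hω j
  have h2 : ∑ k ∈ Finset.Ico (j * h) ((j + 1) * h), P k ω
      = ∑ i ∈ Finset.range h, P (j * h + i) ω := by
    rw [Finset.sum_Ico_eq_sum_range, add_mul, one_mul, Nat.add_sub_cancel_left]
  have h3 : (∑ i ∈ Finset.range h, P (j * h + i) ω).IsHermitian := by
    rw [Matrix.IsHermitian, Matrix.conjTranspose_sum]
    exact Finset.sum_congr rfl fun i _ => (hPherm _ ω).eq
  have h4 := mul_norm_sq_le_of_le_lambdaMin h3 (h2 ▸ h1 :) (e ω)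
  rw [Matrix.sum_mulVec, dotProduct_sum] at h4
  exact h4

end SensorNetwork

end

/-! ### Convergence of the estimates -/

theorem theorem2 {Ω : Type*} [MeasurableSpace Ω] (μ : Measure Ω) [IsProbabilityMeasure μ]
    {N n d : ℕ} {m : Fin N → ℕ} (S : SensorNetwork Ω N n d m)
    (x₀ : Fin n → ℝ) (a b : ℕ → ℝ)
    (ξ : Fin N → Fin n → ℝ) (x : ℤ → Fin N → Ω → Fin n → ℝ)
    (hx : S.IsEstimate x₀ a b ξ x)
    (hloops : S.NoSelfLoops μ)
    (hdelay : S.DelayFree μ)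
    (hindep : S.NoiseIndep μ)
    (hnoise : S.NoiseMartingaleDifference μ)
    (hgain : GainCondition a b)
    (h : ℕ) (hh : 0 < h) (θ ρ₀ : ℝ) (hθ : 0 < θ) (hρ₀ : 0 < ρ₀)
    (hexc : S.PersistentlyExciting μ a b h θ)
    (hmom : S.BoundedConditionalMoments μ h ρ₀)
    (hbdd : S.BoundedPaths μ)
    (hb : Summable fun k => b k ^ 2) :
    ∀ᵐ ω ∂μ, ∀ i : Fin N, Tendsto (fun k : ℕ => x (k : ℤ) i ω) atTop (𝓝 x₀) := by
  obtain ⟨Y, ρ, K, R⟩ :=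
    SensorNetwork.exists_randomLinearRecursion x₀ ξ hindep hnoise hgain hρ₀.le hmom
  have hlim := R.ae_tendsto_zero hgain hb hh hθ fun j A hA =>
    SensorNetwork.mul_setIntegral_le_sum_drift hgain hexc hρ₀.le hmom j
      (S.stronglyMeasurable_estError x₀ a b ξ (j * h)) (R.integrable_sq (j * h)) hA
  have hdelay' : ∀ᵐ ω ∂μ, ∀ k j i, S.delay k j i ω = 0 :=
    ae_all_iff.2 fun k => ae_all_iff.2 fun j => ae_all_iff.2 fun i => hdelay k j i
  filter_upwards [hlim, hdelay'] with ω h1 h2 i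
  refine tendsto_pi_nhds.2 fun c => ?_
  simp_rw [S.sub_eq_estError hx h2]
  have h3 := ((EuclideanSpace.proj (𝕜 := ℝ) (i, c)).continuous.tendsto _).comp h1
  simpa using h3.const_add (x₀ c)
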